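/- Let $T$ be a complete first-order theory in a language without function symbols (constant symbols are allowed), and let $P$ be a unary predicate of its language. Write $|T|$ for the number of formulas of the language, $P^M$ for the interpretation of $P$ in $M\models T$, regarded as a structure with the relations induced from $M$, and assume: - $P^M$ is infinite for every $M\models T$; - $P$ is stably embedded: in every model $M$ of $T$, each subset of a power of $P^M$ that is definable in $M$ with parameters is definable in $M$ with parameters from $P^M$; - in every model $M$ of $T$, each subset of a power of $P^M$ that is $0$-definable in $M$ is $0$-definable in the structure $P^M$; - $T$ eliminates quantifiers down to predicates: every formula $\varphi(x_1,\dots,x_n)$ with $n\ge 1$ is equivalent modulo $T$ to $R(x_1,\dots,x_n)$ for some relation symbol $R$. Definitions. A subset $A$ of a model $N\models T$ is *complete* if for every formula $\psi(\bar x,\bar y)$ and $\bar b\subseteq A$, whenever $N\models\psi(\bar a,\bar b)$ for some tuple $\bar a$ from $P^N$, then $N\models\psi(\bar a',\bar b)$ for some tuple $\bar a'$ from $P^N\cap A$. For $M\models T$, $S_*(M)$ is the set of types $\mathrm{tp}(\bar c/M)$ of finite tuples $\bar c$ in elementary extensions $N$ of $M$ such that $P^N\cap(M\cup\bar c)=P^N\cap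 M$ and $M\cup\bar c$ is complete. A type over $M$ is *algebraic* if it is realized in $M$. $T$ is *nulldimensional over $P$* if for every $M\models T$ every $p\in S_*(M)$ is algebraic. A *Vaughtian pair over $P$* is a pair $(M,N)$ of models of $T$ with $M\prec N$, $M\ne N$ and $P^M=P^N$. A *two-cardinal model* is a model $M\models T$ with $|T|\le|P^M|<|M|$; a model $M$ is *of type $(\kappa,\mu)$* if $|P^M|=\kappa$ and $|M|=\mu$. A structure is $\kappa$-saturated if it realizes every finitely satisfiable set of formulas in one variable over fewer than $\kappa$ parameters, and saturated if it is saturated in its own cardinality. **Theorem.** Let $\lambda$ be a cardinal with $|T|<\lambda=\lambda^{<\lambda}$. The following are equivalent: 1. $T$ is not nulldimensional over $P$. 2. For some saturated $M\models T$ there is a non-algebraic $p\in S_*(M)$. 3. $T$ has a Vaughtian pair $(M,N)$ over $P$. 4. $T$ has a Vaughtian pair $(M,N)$ over $P$ with $P^M=P^N$ saturated of cardinality $\lambda$. 5. $T$ has a two-cardinal model of cardinality $>|T|$. 6. $T$ has a two-cardinal model $M$ with $P^M$ saturated. 7. $T$ has a two-cardinal model $M$ of type $(\lambda,\lambda^+)$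 with $P^M$ saturated. 8. $T$ has a two-cardinal $\lambda$-saturated model of type $(\lambda,\lambda^+)$. -/

import Mathlib

open FirstOrder FirstOrder.Language Cardinal

universe u

namespace ModelsOverP

/-! ### Relational part of a language, structures induced on subsets -/

/-- The relational part of `L` (all relation symbols, no function or constant symbols). Every subset
of an `L`-structure is a structure for it. -/
def relPart (L : FirstOrder.Language.{u, u}) : FirstOrder.Language.{u, u} where
  Functions := fun _ => PEmpty
  Relations := L.Relations

/-- The structure which a subset `A` of an `L`-structure `M` inherits from `M`. -/
instance inducedStructure (L : FirstOrder.Language.{u, u}) (M : Type u) [L.Structure M] (A : Set M) :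
    (relPart L).Structure A where
  funMap := fun f _ => PEmpty.elim f
  RelMap := fun R x => Structure.RelMap (L := L) (M := M) R (fun i => (x i : M))

section Basic

variable {L : FirstOrder.Language.{u, u}}

/-- The interpretation `P^M` of a unary predicate symbol `P`. -/
def pPart (P : L.Relations 1) (M : Type u) [L.Structure M] : Set M :=
  {x | Structure.RelMap P ![x]}

/-- `κ`-saturation: every set of formulas in one variable with fewer than `κ` parameters that is
finitely satisfiable in `M` is realized in `M`. -/
def IsKSaturated (L : FirstOrder.Language.{u, u}) (κ : Cardinal.{u}) (M : Type u) [L.Structure M] : Prop :=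
  ∀ B : Set M, #B < κ → ∀ p : Set (L.Formula (B ⊕ Unit)),
    (∀ q ⊆ p, q.Finite →
      ∃ a : M, ∀ φ ∈ q, φ.Realize (Sum.elim (fun b : B => (b : M)) (fun _ => a))) →
    ∃ a : M, ∀ φ ∈ p, φ.Realize (Sum.elim (fun b : B => (b : M)) (fun _ => a))

/-- `M` is saturated: it is saturated in its own cardinality. -/
def IsSaturated (L : FirstOrder.Language.{u, u}) (M : Type u) [L.Structure M] : Prop :=
  IsKSaturated L #M M

/-- `P^M`, with the structure induced from `M`, is saturated. -/
def HasSaturatedPPart (P : L.Relations 1) (M : Type u) [L.Structure M] : Prop :=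
  IsSaturated (relPart L) (pPart P M)

/-! ### Complete sets and types weakly orthogonal to `P` -/

/-- A subset `A` of `N` is complete (over `P`): every formula with parameters in `A` that is
satisfied in `N` by a tuple from `P^N` is satisfied in `N` by a tuple from `P^N ∩ A`. -/
def IsCompleteSet (P : L.Relations 1) {N : Type u} [L.Structure N] (A : Set N) : Prop :=
  ∀ (k m : ℕ) (ψ : L.Formula (Fin k ⊕ Fin m)) (b : Fin m → N), (∀ i, b i ∈ A) →
    (∃ a : Fin k → N, (∀ i, a i ∈ pPart P N) ∧ ψ.Realize (Sum.elim a b)) →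
    ∃ a : Fin k → N, (∀ i, a i ∈ pPart P N ∩ A) ∧ ψ.Realize (Sum.elim a b)

/-- The complete type over `M` of a finite tuple `c` of an elementary extension `f : M ≺ N`,
as the set of all formulas with parameters in `M` that hold of `c`. -/
def typeOver {M N : Type u} [L.Structure M] [L.Structure N] (f : M ↪ₑ[L] N) {n : ℕ}
    (c : Fin n → N) : Set (L.Formula (M ⊕ Fin n)) :=
  {φ | φ.Realize (Sum.elim f c)}

/-- `S_*(M)` (in `n` variables): the types `tp(c/M)` of `n`-tuples `c` of elementary extensions `N`
of `M` such that `P ∩ (M ∪ c) = P ∩ M` and `M ∪ c` is complete. -/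
def starTypes (P : L.Relations 1) (M : Type u) [L.Structure M] (n : ℕ) :
    Set (Set (L.Formula (M ⊕ Fin n))) :=
  {p | ∃ (N : Type u) (_ : L.Structure N) (f : M ↪ₑ[L] N) (c : Fin n → N),
    p = typeOver f c ∧
    pPart P N ∩ (Set.range f ∪ Set.range c) = pPart P N ∩ Set.range f ∧
    IsCompleteSet P (Set.range f ∪ Set.range c)}

/-- A type over `M` is algebraic: it is realized in `M`. -/
def IsAlgebraicType {M : Type u} [L.Structure M] {n : ℕ} (p : Set (L.Formula (M ⊕ Fin n))) :
    Prop :=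
  ∃ a : Fin n → M, p = typeOver (ElementaryEmbedding.refl L M) a

/-! ### Theories -/

/-- The cardinality `|T|` of a theory in the language `L`: the number of `L`-formulas, which is
`|L| + ℵ₀`. -/
noncomputable def theoryCard (_T : L.Theory) : Cardinal.{u} :=
  max L.card ℵ₀

/-- The standing assumptions on a theory `T` with a distinguished unary predicate `P`. -/
structure IsTheoryOverP (T : L.Theory) (P : L.Relations 1) : Prop where
  /-- There are no function symbols (constant symbols are allowed). -/
  no_functions : ∀ n, IsEmpty (L.Functions (n + 1))
  complete : T.IsComplete
  infinite : ∀ M : Theory.ModelType.{u, u, u} T, (pPart P M).Infinite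
  /-- `P` is stably embedded: subsets of powers of `P` definable with arbitrary parameters are
  definable with parameters from `P`. -/
  stablyEmbedded : ∀ (M : Theory.ModelType.{u, u, u} T) (k : ℕ) (D : Set (Fin k → M)),
    (∀ x ∈ D, ∀ i, x i ∈ pPart P M) →
    (Set.univ : Set M).Definable L D → (pPart P M).Definable L D
  /-- Subsets of powers of `P` that are `0`-definable in the model are `0`-definable in the
  structure induced on `P`. -/
  zeroDefinable : ∀ (M : Theory.ModelType.{u, u, u} T) (k : ℕ) (D : Set (Fin k → pPart P M)),
    (∅ : Set M).Definable L ((fun x i => (x i : M)) '' D) →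
    (∅ : Set (pPart P M)).Definable (relPart L) D
  /-- Elimination of quantifiers down to the level of predicates. -/
  quantifierElimination : ∀ (n : ℕ) (φ : L.Formula (Fin (n + 1))),
    ∃ R : L.Relations (n + 1), φ ⇔[T] R.formula (fun i => Term.var i)

/-- `T` is nulldimensional over `P`: for all `M ⊨ T`, every `p ∈ S_*(M)` is algebraic. -/
def Nulldimensional (T : L.Theory) (P : L.Relations 1) : Prop :=
  ∀ (M : Theory.ModelType.{u, u, u} T) (n : ℕ), ∀ p ∈ starTypes P M n, IsAlgebraicType p

/-- `(M, N)` is a Vaughtian pair over `P`: `M ≺ N`, `M ≠ N` and `P^M = P^N`. -/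
def IsVaughtianPair (P : L.Relations 1) {N : Type u} [L.Structure N]
    (M : L.ElementarySubstructure N) : Prop :=
  (M : Set N) ≠ Set.univ ∧ ((↑) : M → N) '' pPart P M = pPart P N

/-- A model `M` of `T` is a two-cardinal model over `P`: `|T| ≤ |P^M| < |M|`. -/
def IsTwoCardinal (T : L.Theory) (P : L.Relations 1) (M : Theory.ModelType.{u, u, u} T) : Prop :=
  theoryCard T ≤ #(pPart P M) ∧ #(pPart P M) < #M

/-- `M` is of type `(κ, μ)` over `P`: `|P^M| = κ` and `|M| = μ`. -/
def IsOfType (P : L.Relations 1) (M : Type u) [L.Structure M] (κ μ : Cardinal.{u}) : Prop :=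
  #(pPart P M) = κ ∧ #M = μ

end Basic

end ModelsOverP

open ModelsOverP

/-! The implications back to 1 are soft. Downward Löwenheim–Skolem over the `P`-part turns a
two-cardinal model into a Vaughtian pair. For a Vaughtian pair `(M, N)`, any `c` in `N` outside `M`
has a non-algebraic type in `S_*(M)`, because all of `P^N` already lies in `M`. The content is in
passing from 1 to 2, 4 and 8.

A non-algebraic type in `S_*(M)` gives a complete set `A` properly containing `M` and having no new
points of `P`. With `M` and `A` named by predicates this is expressed by sentences, so `λ^{<λ} = λ`
yields a saturated version of size `λ` (`exists_saturatedPair`). There `M` is `λ`-saturated, which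
gives 2, and completeness implies that small types over `A` finitely satisfiable in `P` are realized
in `P ∩ M`. A back-and-forth that goes back only for points of `P` then embeds `A` elementarily into
`M`, covering `P^M` (`exists_sameType_covering`). Its restriction to `M` is an elementary map `f : M
→ M` which covers `P^M` but misses the image of a point of `A` outside `M`; so `(f(M), M)` is the
pair required in 4.

For 8, such extensions are iterated `λ⁺` times inside a `λ⁺`-saturated model. The obstacle is that a
union at a limit stage need not be saturated. Stable embeddedness removes it: on `P`, formulas over
a submodel `S` reduce to parameters from `P^S`, and `P^S` is a copy of `P^M`. So `S` still embeds
into `M` covering `P^M`; following this by `f` makes the image proper, and extending the inverse map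
to all of `M` gives a saturated proper extension of `S` with the same `P`-part
(`exists_proper_extension`). The union of the chain has size `λ⁺`, its `P`-part has size `λ`, and it
is `λ`-saturated since small parameter sets lie in one member. -/

namespace ModelsOverP

/-! ### Set theory -/

/-- A transfinite sequence meeting all the requirements `D i`, each term extending all the
previous ones in the sense of `r`. -/
theorem exists_transfinite_seq {X : Type*} [Nonempty X] {ι : Type*} [LinearOrder ι]
    [WellFoundedLT ι] (r : X → X → Prop) (D : ι → X → Prop)
    (H : ∀ (i : ι) (f : Set.Iio i → X), (∀ j k, j < k → r (f j) (f k)) →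
      ∃ y, D i y ∧ ∀ j, r (f j) y) :
    ∃ f : ι → X, (∀ i, D i (f i)) ∧ ∀ i j, i < j → r (f i) (f j) := by
  classical
  -- The default value is used only if the earlier terms fail to form a chain, which the induction
  -- below excludes.
  let step : (i : ι) → ((j : ι) → j < i → X) → X := fun i g =>
    if h : ∀ j k : Set.Iio i, j < k → r (g j j.2) (g k k.2) then
      (H i (fun j => g j j.2) h).choose
    else Classical.arbitrary X
  let f : ι → X := (wellFounded_lt (α := ι)).fix step
  have hf : ∀ i, f i = step i fun j _ => f j := fun i => (wellFounded_lt (α := ι)).fix_eq step i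
  have key : ∀ i, D i (f i) ∧ ∀ j < i, r (f j) (f i) := by
    intro i
    induction i using (wellFounded_lt (α := ι)).induction with
    | _ i ih =>
    have h : ∀ j k : Set.Iio i, j < k → r (f j) (f k) := fun j k hjk => (ih k k.2).2 j hjk
    have h2 := (H i (fun j => f j) h).choose_spec
    have h3 : f i = (H i (fun j => f j) h).choose := by
      rw [hf i]; simp only [step]; rw [dif_pos h]
    rw [h3]
    exact ⟨h2.1, fun j hj => h2.2 ⟨j, hj⟩⟩
  exact ⟨f, fun i => (key i).1, fun i j hij => (key j).2 i hij⟩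

theorem mk_Iio_ord_lt {κ : Cardinal.{u}} (i : κ.ord.ToType) : #(Set.Iio i) < κ := by
  simpa using mk_Iio_lt i

theorem exists_surjective_of_mk_le {α β : Type u} [Nonempty β] (h : #β ≤ #α) :
    ∃ f : α → β, Function.Surjective f := by
  obtain ⟨g⟩ := h
  exact ⟨Function.invFun g, Function.invFun_surjective g.injective⟩

/-- A small family of elements of a regular cardinal is bounded. -/
theorem exists_upper_bound {κ : Cardinal.{u}} (hκ : κ.IsRegular) {β : Type u} (hβ : #β < κ)
    (f : β → κ.ord.ToType) : ∃ i, ∀ b, f b < i := by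
  by_contra! h
  have h1 : #(⋃ b, Set.Iic (f b)) < κ := by
    rw [card_iUnion_lt_iff_forall_of_isRegular hκ hβ]
    intro b
    rw [← Set.Iio_insert]
    exact (mk_insert_le).trans_lt
      (add_lt_of_lt hκ.aleph0_le (mk_Iio_ord_lt _) (one_lt_aleph0.trans_le hκ.aleph0_le))
  have h2 : (⋃ b, Set.Iic (f b)) = Set.univ := by
    ext i; simpa using h i
  rw [h2, mk_univ, mk_ord_toType] at h1
  exact h1.false

/-- A subset of size below `κ` is the range of a map from a proper initial segment of `κ`; there are
`κ` segments, and at most `μ` maps from each. -/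
theorem mk_small_subsets_le {α : Type u} {κ μ : Cardinal.{u}} (hκ : κ ≤ μ) (hμ : ℵ₀ ≤ μ)
    (hα : #α ≤ μ) (hpow : ∀ ν < κ, μ ^ ν ≤ μ) : #{p : Set α // #p < κ} ≤ μ := by
  let F : (Σ i : κ.ord.ToType, (Set.Iio i → α)) → Set α := fun x => Set.range x.2
  have h1 : {p : Set α | #p < κ} ⊆ Set.range F := by
    intro p hp
    have hlt : (#p).ord < κ.ord := ord_lt_ord.2 hp
    let i : κ.ord.ToType := Ordinal.ToType.mk ⟨(#p).ord, hlt⟩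
    have hi : #(Set.Iio i) = #p := by
      have h2 : Ordinal.typein (α := κ.ord.ToType) (· < ·) i = (#p).ord :=
        Ordinal.typein_enum _ _
      have h3 := congrArg Ordinal.card h2
      rwa [Ordinal.card_typein, card_ord] at h3
    obtain ⟨e⟩ := Cardinal.eq.1 hi
    refine ⟨⟨i, fun x => e x⟩, ?_⟩
    ext a
    simp only [F, Set.mem_range]
    exact ⟨fun ⟨y, hy⟩ => hy ▸ (e y).2, fun ha => ⟨e.symm ⟨a, ha⟩, by simp⟩⟩
  calc #{p : Set α // #p < κ} ≤ #(Set.range F) := mk_le_mk_of_subset h1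
    _ ≤ #(Σ i : κ.ord.ToType, (Set.Iio i → α)) := mk_range_le
    _ = Cardinal.sum fun i : κ.ord.ToType => #(Set.Iio i → α) := mk_sigma _
    _ ≤ Cardinal.sum fun _ : κ.ord.ToType => μ := by
        refine Cardinal.sum_le_sum _ _ fun i => ?_
        rw [← power_def]
        exact (power_le_power_right hα).trans (hpow _ (mk_Iio_ord_lt i))
    _ = κ * μ := by simp
    _ ≤ μ := (mul_le_mul_left hκ μ).trans (mul_eq_self hμ).le

/-- König's theorem: `κ < κ ^ cof κ`, so the cofinality cannot be below `κ`. -/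
theorem isRegular_of_powerlt_eq {κ : Cardinal.{u}} (hκ : ℵ₀ ≤ κ) (h : κ ^< κ = κ) :
    κ.IsRegular := by
  refine ⟨hκ, ?_⟩
  by_contra! hlt
  exact (lt_power_cof_ord hκ).not_ge ((le_powerlt κ hlt).trans h.le)

/-- Hausdorff's argument: by regularity of the successor, a map from `c ≤ ν` points into it is
bounded, and each bound admits at most `ν ^ c ≤ ν` maps. -/
theorem succ_power_le {ν c : Cardinal.{u}} (hν : ℵ₀ ≤ ν) (hc : c ≤ ν) (h : ν ^ c ≤ ν) :
    Order.succ ν ^ c ≤ Order.succ ν := by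
  have hreg := isRegular_succ hν
  induction c using Cardinal.inductionOn with | _ β
  let ι := (Order.succ ν).ord.ToType
  let F : (Σ i : ι, (β → Set.Iio i)) → (β → ι) := fun x b => x.2 b
  have hF : Function.Surjective F := by
    intro f
    obtain ⟨i, hi⟩ := exists_upper_bound hreg (Order.lt_succ_of_le hc) f
    exact ⟨⟨i, fun b => ⟨f b, hi b⟩⟩, rfl⟩
  have h0 : #ι = Order.succ ν := mk_ord_toType _
  calc Order.succ ν ^ #β = #(β → ι) := by rw [← power_def, h0]
    _ ≤ #(Σ i : ι, (β → Set.Iio i)) := mk_le_of_surjective hF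
    _ = Cardinal.sum fun i : ι => #(β → Set.Iio i) := mk_sigma _
    _ ≤ Cardinal.sum fun _ : ι => ν := by
        refine Cardinal.sum_le_sum _ _ fun i => ?_
        rw [← power_def]
        exact (power_le_power_right (Order.lt_succ_iff.1 (mk_Iio_ord_lt i))).trans h
    _ = Order.succ ν * ν := by rw [sum_const']; rw [h0]
    _ ≤ Order.succ ν := by
        refine (mul_le_mul_right (Order.le_succ ν) _).trans (mul_eq_self hreg.aleph0_le).le

/-- There are arbitrarily large regular cardinals `μ` with `μ ^ κ = μ`. -/
theorem exists_isRegular_power_le {κ : Cardinal.{u}} (hκ : ℵ₀ ≤ κ) :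
    ∃ μ : Cardinal.{u}, κ < μ ∧ μ.IsRegular ∧ ∀ ν ≤ κ, μ ^ ν ≤ μ := by
  have h2 : κ ≤ 2 ^ κ := (cantor κ).le
  -- `2 ^ κ` already absorbs powers up to `κ`; its successor inherits this and is moreover regular.
  refine ⟨Order.succ (2 ^ κ), Order.lt_succ_of_le h2, isRegular_succ (hκ.trans h2),
    fun ν hν => succ_power_le (hκ.trans h2) (hν.trans h2) ?_⟩
  rw [← power_mul]
  exact power_le_power_left two_ne_zero ((mul_le_mul_right hν κ).trans (mul_eq_self hκ).le)

/-! ### Realizing small sets of formulas, compactness, saturated models -/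

section Henkin

variable {L : FirstOrder.Language.{u, u}}

theorem mk_formula_le (L : FirstOrder.Language.{u, u}) (α : Type u) {κ : Cardinal.{u}}
    (hL : max L.card ℵ₀ ≤ κ) (hα : #α ≤ κ) : #(L.Formula α) ≤ κ := by
  have hκ : ℵ₀ ≤ κ := (le_max_right _ _).trans hL
  have h1 : #(L.Formula α) ≤ #(Σ n, L.BoundedFormula α n) :=
    mk_le_of_injective (f := fun φ : L.Formula α => ⟨0, φ⟩) fun a b h => by simpa using h
  refine (h1.trans BoundedFormula.card_le).trans (max_le hκ ?_)
  simpa using add_le_of_le hκ hα ((le_max_left _ _).trans hL)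

theorem mk_formula_lt (L : FirstOrder.Language.{u, u}) (α : Type u) {κ : Cardinal.{u}}
    (hL : max L.card ℵ₀ < κ) (hα : #α < κ) : #(L.Formula α) < κ :=
  (mk_formula_le L α (le_max_left (max L.card ℵ₀) #α) (le_max_right _ _)).trans_lt (max_lt hL hα)

/-- Every finitely satisfiable set of fewer than `κ` formulas in one variable with parameters
is realized. -/
def RealizesSmallSets (L : FirstOrder.Language.{u, u}) (κ : Cardinal.{u}) (M : Type u)
    [L.Structure M] : Prop :=
  ∀ (α : Type u) (w : α → M) (p : Set (L.Formula (α ⊕ Unit))), #p < κ →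
    (∀ q ⊆ p, q.Finite → ∃ a : M, ∀ φ ∈ q, φ.Realize (Sum.elim w fun _ => a)) →
    ∃ a : M, ∀ φ ∈ p, φ.Realize (Sum.elim w fun _ => a)

/-- As the language is smaller than `κ`, fewer than `κ` parameters leave fewer than `κ` formulas.
Counting formulas instead lets the parameters be any indexed family, even a large one. -/
theorem RealizesSmallSets.isKSaturated {κ : Cardinal.{u}} {M : Type u} [L.Structure M]
    (hL : max L.card ℵ₀ < κ) (h : RealizesSmallSets L κ M) : IsKSaturated L κ M := by
  intro B hB p hp
  refine h B (fun b => b) p ((mk_set_le p).trans_lt (mk_formula_lt L _ hL ?_)) hp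
  rw [mk_sum, lift_uzero]
  exact add_lt_of_lt ((le_max_right _ _).trans hL.le) hB
    (by simpa using one_lt_aleph0.trans ((le_max_right _ _).trans_lt hL))

/-- A formula depends on finitely many variables only. -/
theorem exists_finset_realize_congr {α : Type*} (φ : L.Formula α) :
    ∃ s : Finset α, ∀ (M : Type u) [L.Structure M] (v w : α → M), (∀ a ∈ s, v a = w a) →
      (φ.Realize v ↔ φ.Realize w) := by
  classical
  refine ⟨φ.freeVarFinset, fun M _ v w h => ?_⟩
  have h1 := BoundedFormula.realize_restrictFreeVar (M := M) (φ := φ) (f := fun a => (a : α))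
    (v := v) (xs := default) v (fun _ => rfl)
  have h2 := BoundedFormula.realize_restrictFreeVar (M := M) (φ := φ) (f := id)
    (v := fun a => v a) (xs := default) v (fun _ => rfl)
  have h3 := BoundedFormula.realize_restrictFreeVar (M := M) (φ := φ) (f := id)
    (v := fun a => v a) (xs := default) w (fun a => h a a.2)
  exact h2.symm.trans h3

/-- The conjunction of a finite set of formulas. -/
noncomputable def finConj {α : Type*} (q : Set (L.Formula α)) (hq : q.Finite) : L.Formula α :=
  haveI := hq.to_subtype
  Formula.iInf fun φ : q => φ.1

theorem realize_finConj {α : Type*} {q : Set (L.Formula α)} {hq : q.Finite} {M : Type*}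
    [L.Structure M] {v : α → M} : (finConj q hq).Realize v ↔ ∀ φ ∈ q, φ.Realize v := by
  have := hq.to_subtype
  simp [finConj, Formula.realize_iInf]

/-- A set of formulas is satisfied by an assignment in some model of `T`. -/
def SatWith (T : L.Theory) {V : Type u} (Γ : Set (L.Formula V)) : Prop :=
  ∃ (M : Theory.ModelType.{u, u, u} T) (v : V → M), ∀ φ ∈ Γ, φ.Realize v

theorem SatWith.mono {T : L.Theory} {V : Type u} {Γ Δ : Set (L.Formula V)} (h : SatWith T Δ)
    (hs : Γ ⊆ Δ) : SatWith T Γ :=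
  let ⟨M, v, hv⟩ := h
  ⟨M, v, fun φ hφ => hv φ (hs hφ)⟩

/-- Compactness for sets of formulas. -/
theorem satWith_of_finite {T : L.Theory} {V : Type u} {Γ : Set (L.Formula V)}
    (h : ∀ q ⊆ Γ, q.Finite → SatWith T q) : SatWith T Γ := by
  classical
  let T' : L[[V]].Theory := (L.lhomWithConstants V).onTheory T ∪ Formula.equivSentence '' Γ
  have hT' : T'.IsSatisfiable := by
    rw [Theory.isSatisfiable_iff_isFinitelySatisfiable]
    intro T0 hT0
    let q : Set (L.Formula V) := {φ ∈ Γ | Formula.equivSentence φ ∈ T0}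
    have hq : q.Finite :=
      (T0.finite_toSet.preimage (Formula.equivSentence.injective.injOn)).subset fun φ hφ => hφ.2
    obtain ⟨M, v, hv⟩ := h q (fun φ hφ => hφ.1) hq
    let : (constantsOn V).Structure M := constantsOn.structure v
    have hmod : M ⊨ (L.lhomWithConstants V).onTheory T ∪ Formula.equivSentence '' q := by
      rw [Theory.model_union_iff]
      refine ⟨(LHom.onTheory_model _ T).2 inferInstance, ⟨?_⟩⟩
      rintro _ ⟨φ, hφ, rfl⟩
      exact (Formula.realize_equivSentence M φ).2 (hv φ hφ)
    refine (Theory.Model.isSatisfiable M).mono (T' := (L.lhomWithConstants V).onTheory T ∪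
      Formula.equivSentence '' q) fun ψ hψ => ?_
    rcases hT0 hψ with h1 | ⟨φ, hφ, rfl⟩
    · exact Or.inl h1
    · exact Or.inr ⟨φ, ⟨hφ, hψ⟩, rfl⟩
  obtain ⟨M⟩ := hT'
  have hM : M ⊨ (L.lhomWithConstants V).onTheory T ∪ Formula.equivSentence '' Γ := M.is_model
  rw [Theory.model_union_iff] at hM
  let : L.Structure M := (L.lhomWithConstants V).reduct M
  have : (L.lhomWithConstants V).IsExpansionOn M := LHom.isExpansionOn_reduct _ _
  have : M ⊨ T := (LHom.onTheory_model (L.lhomWithConstants V) T).1 hM.1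
  refine ⟨Theory.ModelType.of T M, fun a => (L.con a : M), fun φ hφ => ?_⟩
  exact (Formula.realize_equivSentence M φ).1
    (hM.2.realize_of_mem _ (Set.mem_image_of_mem _ hφ))

/-- Substitution of the variable `c` for the distinguished variable. -/
def plugIn {V : Type*} (c : V) (φ : L.Formula (V ⊕ Unit)) : L.Formula V :=
  φ.relabel (Sum.elim id fun _ => c)

theorem realize_plugIn {V M : Type*} [L.Structure M] {c : V} {φ : L.Formula (V ⊕ Unit)}
    {v : V → M} : (plugIn c φ).Realize v ↔ φ.Realize (Sum.elim v fun _ => v c) := by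
  rw [plugIn, Formula.realize_relabel]
  have : v ∘ Sum.elim id (fun _ : Unit => c) = Sum.elim v fun _ => v c := by
    ext x; rcases x with x | x <;> rfl
  rw [this]

/-- The existential closure, over the distinguished variable, of a finite conjunction. -/
noncomputable def exConj {V : Type*} (q : Set (L.Formula (V ⊕ Unit))) (hq : q.Finite) :
    L.Formula V :=
  (finConj q hq).iExs Unit

theorem realize_exConj {V M : Type*} [L.Structure M] {q : Set (L.Formula (V ⊕ Unit))}
    {hq : q.Finite} {v : V → M} :
    (exConj q hq).Realize v ↔ ∃ a : M, ∀ φ ∈ q, φ.Realize (Sum.elim v fun _ => a) := by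
  rw [exConj, Formula.realize_iExs]
  simp only [realize_finConj]
  exact ⟨fun ⟨f, hf⟩ => ⟨f (), hf⟩, fun ⟨a, ha⟩ => ⟨fun _ => a, ha⟩⟩

/-- The requirement that `Γ` decides the set of formulas `p`: it puts a variable into `p` or
refutes a finite part of `p`. -/
def Decides {V : Type u} (p : Set (L.Formula (V ⊕ Unit))) (Γ : Set (L.Formula V)) : Prop :=
  (∃ c, plugIn c '' p ⊆ Γ) ∨ ∃ (q : Set (L.Formula (V ⊕ Unit))) (hq : q.Finite), q ⊆ p ∧
    (exConj q hq).not ∈ Γ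

/-- One Henkin step: try to put a variable `c` not yet used into `p`. If this is inconsistent,
compactness isolates a finite part of `p`, and freshness of `c` shows that `Γ` itself refutes its
existential closure. -/
theorem exists_decides {T : L.Theory} {V : Type u} {μ : Cardinal.{u}} (hμ : ℵ₀ ≤ μ)
    (hV : #V = μ) {Γ : Set (L.Formula V)} (hΓ : #Γ < μ) (hs : SatWith T Γ)
    (p : Set (L.Formula (V ⊕ Unit))) (hp : #p < μ) :
    ∃ Δ : Set (L.Formula V), Γ ⊆ Δ ∧ #Δ < μ ∧ SatWith T Δ ∧ Decides p Δ := by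
  classical
  choose s hs1 using fun φ : L.Formula V => exists_finset_realize_congr φ
  choose t ht1 using fun φ : L.Formula (V ⊕ Unit) => exists_finset_realize_congr φ
  -- For uncountable `μ`, each finite set is bounded by `ℵ₀`; for `μ = ℵ₀` this is a finite union of
  -- finite sets.
  have hfin : ∀ {β : Type u} (r : Set β) (g : β → Set V), #r < μ → (∀ b, (g b).Finite) →
      #(⋃ b : r, g b) < μ := by
    intro β r g hr hg
    rcases hμ.lt_or_eq with hlt | rfl
    · refine (mk_iUnion_le_sum_mk.trans (Cardinal.sum_le_sum _ (fun _ => ℵ₀) fun b =>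
        (lt_aleph0_iff_set_finite.2 (hg _)).le)).trans_lt ?_
      rw [sum_const']
      exact mul_lt_of_lt hμ hr hlt
    · have : Finite r := lt_aleph0_iff_finite.1 hr
      exact lt_aleph0_iff_set_finite.2 (Set.finite_iUnion fun b => hg _)
  let used : Set V := (⋃ φ : Γ, (s φ : Set V)) ∪ ⋃ φ : p, (Sum.inl ⁻¹' (t φ : Set (V ⊕ Unit)))
  have hused : #used < μ := by
    refine (mk_union_le _ _).trans_lt (add_lt_of_lt hμ
      (hfin Γ (fun φ => (s φ : Set V)) hΓ fun φ => (s φ).finite_toSet) ?_)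
    exact hfin p (fun φ => Sum.inl ⁻¹' (t φ : Set (V ⊕ Unit))) hp fun φ =>
      (t φ).finite_toSet.preimage Sum.inl_injective.injOn
  obtain ⟨c, hc⟩ : ∃ c, c ∉ used := by
    by_contra! h
    rw [Set.eq_univ_of_forall h, mk_univ, hV] at hused
    exact hused.false
  by_cases hcase : SatWith T (Γ ∪ plugIn c '' p)
  · refine ⟨_, Set.subset_union_left, (mk_union_le _ _).trans_lt
      (add_lt_of_lt hμ hΓ (mk_image_le.trans_lt hp)), hcase, Or.inl ⟨c, Set.subset_union_right⟩⟩
  · have : ∃ q ⊆ Γ ∪ plugIn c '' p, q.Finite ∧ ¬ SatWith T q := by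
      by_contra! h
      exact hcase (satWith_of_finite h)
    obtain ⟨q, hqs, hq, hqn⟩ := this
    have hq' : ∃ q0 ⊆ p, q0.Finite ∧ q ⊆ Γ ∪ plugIn c '' q0 := by
      have h1 : (q \ Γ) ⊆ plugIn c '' p := fun φ hφ => (hqs hφ.1).resolve_left hφ.2
      obtain ⟨q0, hq0, hq0f, h2⟩ :=
        Set.exists_subset_image_finite_and (f := plugIn c) (s := p)
          (p := fun t => t = q \ Γ) |>.1 ⟨q \ Γ, h1, hq.subset Set.sdiff_subset, rfl⟩
      refine ⟨q0, hq0, hq0f, fun φ hφ => ?_⟩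
      by_cases h : φ ∈ Γ
      · exact Or.inl h
      · exact Or.inr (h2 ▸ ⟨hφ, h⟩)
    obtain ⟨q0, hq0p, hq0, hqq⟩ := hq'
    refine ⟨insert (exConj q0 hq0).not Γ, Set.subset_insert _ _, mk_insert_le.trans_lt
      (add_lt_of_lt hμ hΓ (one_lt_aleph0.trans_le hμ)), ?_,
      Or.inr ⟨q0, hq0, hq0p, Set.mem_insert _ _⟩⟩
    obtain ⟨M, v, hv⟩ := hs
    refine ⟨M, v, ?_⟩
    rintro φ (rfl | hφ)
    · rw [Formula.realize_not, realize_exConj]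
      rintro ⟨a, ha⟩
      -- Reassigning the fresh variable `c` to a witness changes no formula of `Γ` or parameter of
      -- `p`.
      refine hqn ⟨M, Function.update v c a, fun φ hφ => ?_⟩
      have hne : ∀ x ∈ used, Function.update v c a x = v x := fun x hx =>
        Function.update_of_ne (fun h : x = c => hc (h ▸ hx)) _ _
      rcases hqq hφ with h | ⟨ψ, hψ, rfl⟩
      · refine (hs1 φ M _ v fun x hx => hne x ?_).2 (hv φ h)
        exact Or.inl (Set.mem_iUnion.2 ⟨⟨φ, h⟩, hx⟩)
      · rw [realize_plugIn]
        refine (ht1 ψ M _ _ fun x hx => ?_).2 (ha ψ hψ)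
        rcases x with x | x
        · exact hne x (Or.inr (Set.mem_iUnion.2 ⟨⟨ψ, hq0p hψ⟩, hx⟩))
        · simp
    · exact hv φ hφ

/-- Closure of a subset under witnesses for formulas makes it an elementary substructure. -/
theorem exists_elementarySubstructure_of_witnesses {M : Type u} [L.Structure M] (S : Set M)
    (h : ∀ (n : ℕ) (φ : L.Formula (Fin n ⊕ Unit)) (x : Fin n → M), (∀ i, x i ∈ S) →
      (∃ a, φ.Realize (Sum.elim x fun _ => a)) →
      ∃ a ∈ S, φ.Realize (Sum.elim x fun _ => a)) :
    ∃ N : L.ElementarySubstructure M, (N : Set M) = S := by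
  let N0 : L.Substructure M :=
    { carrier := S
      fun_mem := by
        intro n f x hx
        -- Closure under functions, constants included, is the witness condition for the formula `y
        -- = f(x)`.
        obtain ⟨a, haS, ha⟩ := h n (Term.equal (Term.var (Sum.inr ()))
          (Term.func f fun i => Term.var (Sum.inl i))) x hx
          ⟨Structure.funMap f x, by simp [Formula.realize_equal]⟩
        simp only [Formula.realize_equal, Term.realize_var, Term.realize_func, Sum.elim_inl,
          Sum.elim_inr] at ha
        exact ha ▸ haS }
  refine ⟨N0.toElementarySubstructure ?_, rfl⟩
  intro n φ x a ha
  let g : Fin (n + 1) → Fin n ⊕ Unit := Fin.snoc (fun i => Sum.inl i) (Sum.inr ())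
  let ψ : L.Formula (Fin n ⊕ Unit) := φ.toFormula.relabel (Sum.elim Empty.elim g)
  have hψ : ∀ b : M, ψ.Realize (Sum.elim (fun i => (x i : M)) fun _ => b) ↔
      φ.Realize default (Fin.snoc ((↑) ∘ x) b : _ → M) := by
    intro b
    rw [Formula.realize_relabel, BoundedFormula.realize_toFormula]
    have h1 : ((Sum.elim (fun i => (x i : M)) fun _ => b) ∘ Sum.elim Empty.elim g) ∘ Sum.inr =
        (Fin.snoc ((↑) ∘ x) b : Fin (n + 1) → M) := by
      ext i
      refine Fin.lastCases ?_ (fun i => ?_) i <;> simp [g]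
    rw [h1, Unique.eq_default (((Sum.elim (fun i => (x i : M)) fun _ => b) ∘
      Sum.elim Empty.elim g) ∘ Sum.inl)]
  obtain ⟨b, hbS, hb⟩ := h n ψ (fun i => x i) (fun i => (x i).2) ⟨a, (hψ a).2 ha⟩
  exact ⟨⟨b, hbS⟩, (hψ b).1 hb⟩

theorem elementarySubstructure_realize_iff {M : Type u} [L.Structure M]
    (N : L.ElementarySubstructure M) {α : Type*} (φ : L.Formula α) (v : α → N) :
    φ.Realize (fun a => (v a : M)) ↔ φ.Realize v :=
  N.subtype.map_formula φ v

/-- Existence of saturated models. -/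
theorem exists_realizesSmallSets (T : L.Theory) (hT : T.IsSatisfiable) {κ μ : Cardinal.{u}}
    (hκμ : κ ≤ μ) (hL : max L.card ℵ₀ < κ) (hμ : μ.IsRegular) (hpow : ∀ ν < κ, μ ^ ν ≤ μ) :
    ∃ M : Theory.ModelType.{u, u, u} T, RealizesSmallSets L κ M ∧ #M ≤ μ := by
  classical
  let V : Type u := μ.ord.ToType
  let ι : Type u := μ.ord.ToType
  have hV : #V = μ := mk_ord_toType _
  have hμ0 := hμ.aleph0_le
  have : Nonempty V := mk_ne_zero_iff.1 (hV ▸ hμ.ne_zero)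
  let Task := {p : Set (L.Formula (V ⊕ Unit)) // #p < κ}
  have hκ0 : 0 < κ := (aleph0_pos.trans_le (le_max_right _ _)).trans hL
  have : Nonempty Task := ⟨⟨∅, by simpa using hκ0⟩⟩
  have hVU : #(V ⊕ Unit) ≤ μ := by
    rw [mk_sum, lift_uzero, hV]
    exact add_le_of_le hμ0 le_rfl (by simpa using (one_lt_aleph0.trans_le hμ0).le)
  have hTask : #Task ≤ #ι := by
    rw [show #ι = μ from hV]
    exact mk_small_subsets_le hκμ hμ0 (mk_formula_le L _ (hL.le.trans hκμ) hVU) hpow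
  obtain ⟨e, he⟩ := exists_surjective_of_mk_le hTask
  let X := {Γ : Set (L.Formula V) // #Γ < μ ∧ SatWith T Γ}
  have hempty : SatWith T (∅ : Set (L.Formula V)) := by
    obtain ⟨M⟩ := hT
    exact ⟨M, fun _ => Classical.arbitrary M, by simp⟩
  have : Nonempty X := ⟨⟨∅, by simpa using hμ.pos, hempty⟩⟩
  have hunion : ∀ (κ' : Type u) [LinearOrder κ'] (f : κ' → X), (∀ j k, j < k → (f j).1 ⊆ (f k).1) →
      SatWith T (⋃ j, (f j).1) := by
    intro κ' _ f hf
    have hmono : Monotone fun j => (f j).1 := fun j k hjk => by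
      rcases hjk.lt_or_eq with h | rfl
      · exact hf j k h
      · exact subset_rfl
    refine satWith_of_finite fun q hq hqf => ?_
    rcases isEmpty_or_nonempty κ' with hE | hN
    · refine hempty.mono (hq.trans (by simp))
    · lift q to Finset (L.Formula V) using hqf
      obtain ⟨i, hi⟩ := hmono.directed_le.exists_mem_subset_of_finset_subset_biUnion hq
      exact (f i).2.2.mono hi
  obtain ⟨f, hfD, hfm⟩ := exists_transfinite_seq (X := X) (ι := ι) (fun Γ Δ => Γ.1 ⊆ Δ.1)
    (fun i Γ => Decides (e i).1 Γ.1) (by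
      intro i f hf
      have h1 : #(⋃ j, (f j).1 : Set (L.Formula V)) < μ :=
        (card_iUnion_lt_iff_forall_of_isRegular hμ (mk_Iio_ord_lt i)).2 fun j => (f j).2.1
      obtain ⟨Δ, hs, hΔ, hsat, hdec⟩ := exists_decides (T := T) hμ0 hV h1 (hunion _ f hf)
        (e i).1 ((e i).2.trans_le hκμ)
      exact ⟨⟨Δ, hΔ, hsat⟩, hdec, fun j => (Set.subset_iUnion (fun j => (f j).1) j).trans hs⟩)
  obtain ⟨M, v, hv⟩ := hunion ι f hfm
  -- If `p` is finitely satisfiable in `M`, none of its finite parts was refuted, so its task was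
  -- met by a variable.
  have hdec : ∀ p : Set (L.Formula (V ⊕ Unit)), #p < κ →
      (∀ q ⊆ p, q.Finite → ∃ a : M, ∀ φ ∈ q, φ.Realize (Sum.elim v fun _ => a)) →
      ∃ c, ∀ φ ∈ p, φ.Realize (Sum.elim v fun _ => v c) := by
    intro p hp hfs
    obtain ⟨i, hi⟩ := he ⟨p, hp⟩
    have := hfD i
    rw [hi] at this
    rcases this with ⟨c, hc⟩ | ⟨q, hq, hqp, hqn⟩
    · exact ⟨c, fun φ hφ => realize_plugIn.1
        (hv _ (Set.mem_iUnion.2 ⟨i, hc (Set.mem_image_of_mem _ hφ)⟩))⟩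
    · have h1 := hv _ (Set.mem_iUnion.2 ⟨i, hqn⟩)
      rw [Formula.realize_not, realize_exConj] at h1
      exact absurd (hfs q hqp hq) h1
  -- The model sought is the set of values of the `μ` variables, which bounds its size. Singleton
  -- tasks provide the witnesses for elementarity.
  obtain ⟨N, hN⟩ := exists_elementarySubstructure_of_witnesses (L := L) (Set.range v) (by
    intro n φ x hx ⟨a, ha⟩
    choose y hy using hx
    have key : ∀ b, (φ.relabel (Sum.map y id) : L.Formula (V ⊕ Unit)).Realize
        (Sum.elim v fun _ => b) ↔ φ.Realize (Sum.elim x fun _ => b) := by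
      intro b
      rw [Formula.realize_relabel, Sum.elim_comp_map, show v ∘ y = x from funext hy]
      rfl
    obtain ⟨c, hc⟩ := hdec {φ.relabel (Sum.map y id)}
      (by rw [mk_singleton]; exact (one_lt_aleph0.trans_le (le_max_right _ _)).trans hL)
      (fun q hq _ => ⟨a, fun ψ hψ => by rw [hq hψ, key]; exact ha⟩)
    exact ⟨v c, ⟨c, rfl⟩, (key _).1 (hc _ rfl)⟩)
  have hsat : RealizesSmallSets L κ N := by
    intro α w p hp hfs
    have hw : ∀ a, ∃ c, v c = (w a : M) := fun a => by
      have : (w a : M) ∈ (N : Set M) := (w a).2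
      rwa [hN] at this
    choose y hy using hw
    have key : ∀ (φ : L.Formula (α ⊕ Unit)) (b : N),
        (φ.relabel (Sum.map y id) : L.Formula (V ⊕ Unit)).Realize
        (Sum.elim v fun _ => (b : M)) ↔ φ.Realize (Sum.elim w fun _ => b) := by
      intro φ b
      rw [Formula.realize_relabel, Sum.elim_comp_map, ← elementarySubstructure_realize_iff N φ]
      refine iff_of_eq (congrArg _ ?_)
      ext x
      rcases x with x | x
      · exact hy x
      · rfl
    obtain ⟨c, hc⟩ := hdec ((fun φ => φ.relabel (Sum.map y id)) '' p) (mk_image_le.trans_lt hp) (by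
      intro q hq hqf
      obtain ⟨q0, hq0, hq0f, rfl⟩ := Set.exists_subset_image_finite_and.1 ⟨q, hq, hqf, rfl⟩
      obtain ⟨a, ha⟩ := hfs q0 hq0 hq0f
      refine ⟨a, ?_⟩
      rintro _ ⟨φ, hφ, rfl⟩
      exact (key φ a).2 (ha φ hφ))
    have hcN : v c ∈ (N : Set M) := hN ▸ ⟨c, rfl⟩
    exact ⟨⟨v c, hcN⟩, fun φ hφ => (key φ ⟨v c, hcN⟩).1 (hc _ ⟨φ, hφ, rfl⟩)⟩
  have hcard : #(N : Set M) ≤ μ := by rw [hN, ← hV]; exact mk_range_le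
  exact ⟨Theory.ModelType.of T N, hsat, hcard⟩

end Henkin

/-! ### Partial elementary maps -/

section Elementary

variable {L : FirstOrder.Language.{u, u}} {N C : Type u} [L.Structure N] [L.Structure C]

/-- The tuples `v` and `w` have the same type. -/
def SameType (L : FirstOrder.Language.{u, u}) {N C : Type u} [L.Structure N] [L.Structure C]
    {α : Type*} (v : α → N) (w : α → C) : Prop :=
  ∀ φ : L.Formula α, φ.Realize v ↔ φ.Realize w

section

variable {α β : Type*} {v : α → N} {w : α → C}

theorem SameType.symm (h : SameType L v w) : SameType L w v := fun φ => (h φ).symm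

theorem SameType.trans {K : Type u} [L.Structure K] {z : α → K} (h : SameType L v w)
    (h' : SameType L w z) : SameType L v z :=
  fun φ => (h φ).trans (h' φ)

theorem SameType.comp (h : SameType L v w) (f : β → α) :
    SameType L (fun b => v (f b)) (fun b => w (f b)) := by
  intro φ
  have := h (φ.relabel f)
  rwa [Formula.realize_relabel, Formula.realize_relabel] at this

theorem sameType_of_finite
    (h : ∀ (n : ℕ) (x : Fin n → α), SameType L (fun i => v (x i)) (fun i => w (x i))) :
    SameType L v w := by
  classical
  intro φ
  let s := BoundedFormula.freeVarFinset φ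
  have key : ∀ (K : Type u) [L.Structure K] (z : α → K),
      (Formula.relabel s.equivFin (BoundedFormula.restrictFreeVar φ id : L.Formula s)).Realize
        (fun i => z (s.equivFin.symm i)) ↔ φ.Realize z := by
    intro K _ z
    rw [Formula.realize_relabel]
    exact BoundedFormula.realize_restrictFreeVar z fun a => by simp
  rw [← key, ← key]
  exact h _ (fun i => (s.equivFin.symm i : α)) _

theorem SameType.eq_iff (h : SameType L v w) (a b : α) : v a = v b ↔ w a = w b := by
  simpa [Formula.realize_equal] using h (Term.equal (Term.var a) (Term.var b))

theorem SameType.rel₁_iff (h : SameType L v w) (R : L.Relations 1) (a : α) :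
    v a ∈ pPart R N ↔ w a ∈ pPart R C := by
  simpa [Formula.realize_rel₁, pPart] using h (R.formula₁ (Term.var a))

theorem SameType.exists_iff (h : SameType L v w) {q : Set (L.Formula (α ⊕ Unit))} (hq : q.Finite) :
    (∃ a : N, ∀ φ ∈ q, φ.Realize (Sum.elim v fun _ => a)) ↔
      ∃ c : C, ∀ φ ∈ q, φ.Realize (Sum.elim w fun _ => c) := by
  rw [← realize_exConj (hq := hq), ← realize_exConj (hq := hq)]
  exact h _

theorem sameType_of_forall_imp (h : ∀ φ : L.Formula α, φ.Realize v → φ.Realize w) :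
    SameType L v w := by
  refine fun φ => ⟨h φ, fun hw => ?_⟩
  by_contra hv
  exact (Formula.realize_not (φ := φ)).1 (h φ.not (Formula.realize_not.2 hv)) hw

theorem sameType_elementaryEmbedding (f : N ↪ₑ[L] C) (v : α → N) :
    SameType L v (fun a => f (v a)) :=
  fun φ => (f.map_formula φ v).symm

theorem SameType.exists_elementaryEmbedding {f : N → C} (h : SameType L id f) :
    ∃ g : N ↪ₑ[L] C, ∀ a, g a = f a :=
  ⟨⟨f, fun _ φ x => ((h.comp x) φ).symm⟩, fun _ => rfl⟩

theorem sameType_of_elementarilyEquivalent (h : N ≅[L] C) {α : Type*} [IsEmpty α] (v : α → N)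
    (w : α → C) : SameType L v w := by
  refine sameType_of_finite fun n x => ?_
  rcases n with _ | n
  · intro φ
    have key : ∀ (K : Type u) [L.Structure K] (z : Fin 0 → K),
        φ.Realize z ↔ K ⊨ (φ.relabel Fin.elim0 : L.Sentence) := by
      intro K _ z
      rw [Sentence.Realize, Formula.realize_relabel, Unique.eq_default z]
      exact iff_of_eq (congrArg _ (Subsingleton.elim _ _))
    rw [key, key]
    exact elementarilyEquivalent_iff.1 h _
  · exact (IsEmpty.false (x 0)).elim

/-- The type of `a` over `v`, read over `w`, is finitely satisfiable because existential closures of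
finite conjunctions transfer. -/
theorem SameType.exists_extend {κ : Cardinal.{u}} {α : Type u} {v : α → N} {w : α → C}
    (h : SameType L v w) (hL : max L.card ℵ₀ < κ) (hα : #α < κ) (hC : RealizesSmallSets L κ C)
    (a : N) : ∃ c : C, SameType L (Sum.elim v fun _ : Unit => a) (Sum.elim w fun _ => c) := by
  have hα' : #(α ⊕ Unit) < κ := by
    rw [mk_sum, lift_uzero]
    exact add_lt_of_lt ((le_max_right _ _).trans hL.le) hα
      (by simpa using one_lt_aleph0.trans ((le_max_right _ _).trans_lt hL))
  obtain ⟨c, hc⟩ := hC α w {φ | φ.Realize (Sum.elim v fun _ : Unit => a)}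
    ((mk_set_le _).trans_lt (mk_formula_lt L _ hL hα'))
    (fun q hq hqf => (h.exists_iff hqf).1 ⟨a, hq⟩)
  exact ⟨c, sameType_of_forall_imp hc⟩

end

variable {A : Type u}

/-- A relation `g` between (names of) elements of `N` and elements of `C` is elementary. -/
def IsPartialElem (L : FirstOrder.Language.{u, u}) {N C : Type u} [L.Structure N] [L.Structure C]
    {A : Type u} (v : A → N) (g : Set (A × C)) : Prop :=
  SameType L (fun x : g => v x.1.1) (fun x : g => x.1.2)

variable {v : A → N} {g : Set (A × C)}

theorem isPartialElem_insert {a : A} {c : C}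
    (h : SameType L (Sum.elim (fun x : g => v x.1.1) fun _ : Unit => v a)
      (Sum.elim (fun x : g => x.1.2) fun _ => c)) : IsPartialElem L v (insert (a, c) g) := by
  classical
  let f : (insert (a, c) g : Set (A × C)) → g ⊕ Unit := fun y =>
    if hy : y.1 ∈ g then Sum.inl ⟨y.1, hy⟩ else Sum.inr ()
  have h1 := h.comp f
  have e1 : (fun y => Sum.elim (fun x : g => v x.1.1) (fun _ : Unit => v a) (f y)) =
      fun y => v y.1.1 := by
    funext y
    by_cases hy : y.1 ∈ g
    · simp [f, hy]
    · have : y.1 = (a, c) := y.2.resolve_right hy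
      simp only [f, dif_neg hy, Sum.elim_inr, this]
  have e2 : (fun y => Sum.elim (fun x : g => x.1.2) (fun _ : Unit => c) (f y)) =
      fun y => y.1.2 := by
    funext y
    by_cases hy : y.1 ∈ g
    · simp [f, hy]
    · have : y.1 = (a, c) := y.2.resolve_right hy
      simp only [f, dif_neg hy, Sum.elim_inr, this]
  rw [e1, e2] at h1
  exact h1

theorem isPartialElem_iUnion {ι : Type*} [Nonempty ι] {g : ι → Set (A × C)}
    (hd : Directed (· ⊆ ·) g) (h : ∀ i, IsPartialElem L v (g i)) :
    IsPartialElem L v (⋃ i, g i) := by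
  refine sameType_of_finite fun n x => ?_
  choose i hi using fun k => Set.mem_iUnion.1 (x k).2
  obtain ⟨z, hz⟩ := hd.finite_le i
  exact (h z).comp fun k : Fin n => (⟨x k, hz k (hi k)⟩ : g z)

theorem IsPartialElem.exists_insert {κ : Cardinal.{u}} (h : IsPartialElem L v g)
    (hL : max L.card ℵ₀ < κ) (hg : #g < κ) (hC : RealizesSmallSets L κ C) (a : A) :
    ∃ c : C, IsPartialElem L v (insert (a, c) g) :=
  let ⟨c, hc⟩ := SameType.exists_extend h hL hg hC (v a)
  ⟨c, isPartialElem_insert hc⟩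

theorem IsPartialElem.exists_total (h : IsPartialElem L v g) (ht : ∀ a, ∃ c, (a, c) ∈ g) :
    ∃ F : A → C, SameType L v F ∧ ∀ a, (a, F a) ∈ g := by
  choose F hF using ht
  exact ⟨F, SameType.comp h fun a => (⟨(a, F a), hF a⟩ : g), hF⟩

/-- An elementary map into a `κ`-saturated structure extends to a structure of size less
than `κ`. -/
theorem exists_elementaryEmbedding_extending {κ : Cardinal.{u}} {x : A → N} {w : A → C}
    (h : SameType L x w) (hL : max L.card ℵ₀ < κ) (hN : #N < κ) (hC : RealizesSmallSets L κ C) :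
    ∃ f : N ↪ₑ[L] C, ∀ a, f (x a) = w a := by
  let g0 : Set (N × C) := Set.range fun a => (x a, w a)
  have hg0 : IsPartialElem L (id : N → N) g0 := by
    choose y hy using fun z : g0 => z.2
    have h1 := h.comp y
    have e1 : (fun z => x (y z)) = fun z : g0 => id z.1.1 :=
      funext fun z => congrArg Prod.fst (hy z)
    have e2 : (fun z => w (y z)) = fun z : g0 => z.1.2 :=
      funext fun z => congrArg Prod.snd (hy z)
    rw [e1, e2] at h1
    exact h1
  obtain ⟨g, hg0g, hgmax⟩ := zorn_subset_nonempty {g : Set (N × C) | IsPartialElem L id g}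
    (fun c hc hch hne => by
      have : Nonempty c := hne.to_subtype
      refine ⟨⋃ i : c, i.1, isPartialElem_iUnion hch.directed fun i => hc i.2,
        fun s hs => Set.subset_iUnion (fun i : c => i.1) ⟨s, hs⟩⟩) g0 hg0
  have hg : IsPartialElem L id g := hgmax.prop
  -- Elementarity preserves equality, so `g` is the graph of a partial function on `N` and stays
  -- below `κ` in size.
  have hfst : Function.Injective fun z : g => z.1.1 := fun z z' hz =>
    Subtype.ext (Prod.ext hz ((hg.eq_iff z z').1 hz))
  have hcard : #g < κ := (mk_le_of_injective hfst).trans_lt hN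
  obtain ⟨F, hF, hFg⟩ := hg.exists_total fun a => by
    obtain ⟨c, hc⟩ := hg.exists_insert hL hcard hC a
    exact ⟨c, hgmax.le_of_ge hc (Set.subset_insert _ _) (Set.mem_insert _ _)⟩
  obtain ⟨f, hf⟩ := SameType.exists_elementaryEmbedding hF
  refine ⟨f, fun a => ?_⟩
  rw [hf]
  exact (hg.eq_iff ⟨_, hFg (x a)⟩ ⟨(x a, w a), hg0g ⟨a, rfl⟩⟩).1 rfl

/-- Small sets of formulas over (the family) `v` that are finitely satisfiable in `P` are realized
by members of the family. -/
def RealizesSmallPSets (P : L.Relations 1) (κ : Cardinal.{u}) (v : A → N) : Prop :=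
  ∀ p : Set (L.Formula (A ⊕ Unit)), #p < κ →
    (∀ q ⊆ p, q.Finite → ∃ d ∈ pPart P N, ∀ φ ∈ q, φ.Realize (Sum.elim v fun _ => d)) →
    ∃ a : A, ∀ φ ∈ p, φ.Realize (Sum.elim v fun _ => v a)

/-- The back step, available only for points of `P`: each finite part of the type of `c` over the
range of `g`, together with `P(x)`, pulls back along `g`, so the hypothesis on `v` applies. -/
theorem IsPartialElem.exists_insert_right {P : L.Relations 1} {κ : Cardinal.{u}}
    (h : IsPartialElem L v g) (hL : max L.card ℵ₀ < κ) (hg : #g < κ)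
    (hv : RealizesSmallPSets P κ v) {c : C} (hc : c ∈ pPart P C) :
    ∃ a : A, IsPartialElem L v (insert (a, c) g) := by
  have hα' : #(g ⊕ Unit) < κ := by
    rw [mk_sum, lift_uzero]
    exact add_lt_of_lt ((le_max_right _ _).trans hL.le) hg
      (by simpa using one_lt_aleph0.trans ((le_max_right _ _).trans_lt hL))
  let p0 : Set (L.Formula (g ⊕ Unit)) := {φ | φ.Realize (Sum.elim (fun x : g => x.1.2) fun _ => c)}
  let r : L.Formula (g ⊕ Unit) → L.Formula (A ⊕ Unit) := fun φ =>
    φ.relabel (Sum.map (fun x : g => x.1.1) id)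
  have hr : ∀ (φ : L.Formula (g ⊕ Unit)) (d : N), (r φ).Realize (Sum.elim v fun _ => d) ↔
      φ.Realize (Sum.elim (fun x : g => v x.1.1) fun _ => d) := by
    intro φ d
    rw [Formula.realize_relabel, Sum.elim_comp_map]
    rfl
  obtain ⟨a, ha⟩ := hv (r '' p0)
    (mk_image_le.trans_lt ((mk_set_le _).trans_lt (mk_formula_lt L _ hL hα'))) (by
      intro q hq hqf
      obtain ⟨q0, hq0, hq0f, rfl⟩ := Set.exists_subset_image_finite_and.1 ⟨q, hq, hqf, rfl⟩
      obtain ⟨d, hd⟩ := (SameType.exists_iff h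
        (hq0f.insert (P.formula₁ (Term.var (Sum.inr ()))))).2 ⟨c, by
          rintro φ (rfl | hφ)
          · simpa [Formula.realize_rel₁, pPart] using hc
          · exact hq0 hφ⟩
      refine ⟨d, ?_, ?_⟩
      · simpa [Formula.realize_rel₁, pPart] using hd _ (Set.mem_insert _ _)
      · rintro _ ⟨φ, hφ, rfl⟩
        exact (hr φ d).2 (hd φ (Set.mem_insert_of_mem _ hφ)))
  refine ⟨a, isPartialElem_insert (SameType.symm (sameType_of_forall_imp fun φ hφ => ?_))⟩
  exact (hr φ _).1 (ha _ ⟨φ, hφ, rfl⟩)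

/-- A family over which small sets of formulas finitely satisfiable in `P` are realized maps
elementarily into any saturated structure, covering `P`. -/
theorem exists_sameType_covering {P : L.Relations 1} {κ : Cardinal.{u}} (hκ : κ.IsRegular)
    (hL : max L.card ℵ₀ < κ) (hNC : N ≅[L] C) (hC : RealizesSmallSets L κ C) (hCκ : #C ≤ κ)
    (hAκ : #A ≤ κ) (hv : RealizesSmallPSets P κ v) :
    ∃ F : A → C, SameType L v F ∧ ∀ c ∈ pPart P C, ∃ a, F a = c := by
  have hκ0 := hκ.aleph0_le
  let ι := κ.ord.ToType
  have hι : #ι = κ := mk_ord_toType _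
  -- The extra `none` makes the tasks nonempty, so that they can be enumerated by a surjection.
  let Task := Option (A ⊕ pPart P C)
  have hTask : #Task ≤ #ι := by
    rw [hι, mk_option, mk_sum, lift_id, lift_id]
    exact add_le_of_le hκ0 (add_le_of_le hκ0 hAκ ((mk_set_le _).trans hCκ))
      (one_lt_aleph0.trans_le hκ0).le
  obtain ⟨e, he⟩ := exists_surjective_of_mk_le hTask
  let X := {g : Set (A × C) // IsPartialElem L v g ∧ #g < κ}
  have hempty : IsPartialElem L v (∅ : Set (A × C)) := sameType_of_elementarilyEquivalent hNC _ _
  have : Nonempty X := ⟨⟨∅, hempty, by simpa using hκ.pos⟩⟩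
  have hunion : ∀ (κ' : Type u) [LinearOrder κ'] (f : κ' → X), (∀ j k, j < k → (f j).1 ⊆ (f k).1) →
      IsPartialElem L v (⋃ j, (f j).1) := by
    intro κ' _ f hf
    have hmono : Monotone fun j => (f j).1 := fun j k hjk => by
      rcases hjk.lt_or_eq with h | rfl
      · exact hf j k h
      · exact subset_rfl
    rcases isEmpty_or_nonempty κ' with hE | hN
    · rw [Set.iUnion_of_empty]; exact hempty
    · exact isPartialElem_iUnion hmono.directed_le fun i => (f i).2.1
  obtain ⟨f, hfD, hfm⟩ := exists_transfinite_seq (X := X) (ι := ι) (fun g h => g.1 ⊆ h.1)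
    (fun i g => (∀ a, e i = some (Sum.inl a) → ∃ c, (a, c) ∈ g.1) ∧
      ∀ c, e i = some (Sum.inr c) → ∃ a, (a, (c : C)) ∈ g.1) (by
      intro i f hf
      have h1 : #(⋃ j, (f j).1 : Set (A × C)) < κ :=
        (card_iUnion_lt_iff_forall_of_isRegular hκ (mk_Iio_ord_lt i)).2 fun j => (f j).2.2
      have h2 := hunion _ f hf
      have hins : ∀ z : A × C, #(insert z (⋃ j, (f j).1) : Set (A × C)) < κ := fun z =>
        mk_insert_le.trans_lt (add_lt_of_lt hκ0 h1 (one_lt_aleph0.trans_le hκ0))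
      have hsub : ∀ j, (f j).1 ⊆ ⋃ j, (f j).1 := Set.subset_iUnion fun j => (f j).1
      rcases hi : e i with _ | a | c
      · exact ⟨⟨_, h2, h1⟩, ⟨by simp, by simp⟩, hsub⟩
      · obtain ⟨c, hc⟩ := h2.exists_insert hL h1 hC a
        refine ⟨⟨_, hc, hins _⟩, ⟨fun a' ha' => ⟨c, ?_⟩, fun _ h => by cases h⟩,
          fun j => (hsub j).trans (Set.subset_insert _ _)⟩
        cases ha'
        exact Set.mem_insert _ _
      · obtain ⟨a, ha⟩ := h2.exists_insert_right hL h1 hv c.2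
        refine ⟨⟨_, ha, hins _⟩, ⟨(fun _ h => by cases h), fun c' hc' => ⟨a, ?_⟩⟩,
          fun j => (hsub j).trans (Set.subset_insert _ _)⟩
        cases hc'
        exact Set.mem_insert _ _)
  have hg := hunion ι f hfm
  obtain ⟨F, hF, hFg⟩ := hg.exists_total fun a => by
    obtain ⟨i, hi⟩ := he (some (Sum.inl a))
    obtain ⟨c, hc⟩ := (hfD i).1 a hi
    exact ⟨c, Set.mem_iUnion.2 ⟨i, hc⟩⟩
  refine ⟨F, hF, fun c hc => ?_⟩
  obtain ⟨i, hi⟩ := he (some (Sum.inr ⟨c, hc⟩))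
  obtain ⟨a, ha⟩ := (hfD i).2 _ hi
  exact ⟨a, (hg.eq_iff ⟨_, hFg a⟩ ⟨_, Set.mem_iUnion.2 ⟨i, ha⟩⟩).1 rfl⟩

end Elementary

/-! ### Saturated pairs -/

section Pairs

variable {L : FirstOrder.Language.{u, u}}

/-- A formula with parameters involves finitely many parameters only. -/
theorem exists_formula_fin {α β : Type*} (φ : L.Formula (α ⊕ β)) :
    ∃ (m : ℕ) (x : Fin m → α) (φ' : L.Formula (Fin m ⊕ β)),
      ∀ (M : Type u) [L.Structure M] (v : α → M) (z : β → M),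
        φ'.Realize (Sum.elim (fun i => v (x i)) z) ↔ φ.Realize (Sum.elim v z) := by
  classical
  let s : Finset α := (BoundedFormula.freeVarFinset φ).toLeft
  let f : BoundedFormula.freeVarFinset φ → Fin s.card ⊕ β := fun y =>
    match y with
    | ⟨Sum.inl a, h⟩ => Sum.inl (s.equivFin ⟨a, Finset.mem_toLeft.2 h⟩)
    | ⟨Sum.inr b, _⟩ => Sum.inr b
  refine ⟨s.card, fun i => s.equivFin.symm i, BoundedFormula.restrictFreeVar φ f,
    fun M _ v z => ?_⟩
  refine BoundedFormula.realize_restrictFreeVar _ ?_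
  rintro ⟨a | b, h⟩
  · simp [f]
  · simp [f]

/-- Saturation relative to the set defined by `θ`: conjoin `θ` to every formula, and add `θ` alone
in case `p` is empty. The map `g` allows for a translation of formulas. -/
theorem RealizesSmallSets.exists_and {κ : Cardinal.{u}} {K : Type u} [L.Structure K]
    (h : RealizesSmallSets L κ K) (hκ : ℵ₀ ≤ κ) {α β : Type u} (w : α → K)
    (θ : L.Formula (α ⊕ Unit)) (p : Set β) (g : β → L.Formula (α ⊕ Unit)) (hp : #p < κ)
    (hfs : ∀ q ⊆ p, q.Finite → ∃ a : K, θ.Realize (Sum.elim w fun _ => a) ∧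
      ∀ φ ∈ q, (g φ).Realize (Sum.elim w fun _ => a)) :
    ∃ a : K, θ.Realize (Sum.elim w fun _ => a) ∧
      ∀ φ ∈ p, (g φ).Realize (Sum.elim w fun _ => a) := by
  obtain ⟨a, ha⟩ := h α w ((fun φ => θ ⊓ g φ) '' p ∪ {θ})
    ((mk_union_le _ _).trans_lt (add_lt_of_lt hκ (mk_image_le.trans_lt hp)
      (by rw [mk_singleton]; exact one_lt_aleph0.trans_le hκ))) (by
    intro q hq hqf
    have h1 : q \ {θ} ⊆ (fun φ => θ ⊓ g φ) '' p := fun φ hφ => (hq hφ.1).resolve_right hφ.2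
    obtain ⟨q0, hq0, hq0f, h2⟩ := Set.exists_subset_image_finite_and (p := fun t => t = q \ {θ})
      |>.1 ⟨q \ {θ}, h1, hqf.subset Set.sdiff_subset, rfl⟩
    obtain ⟨a, ha, ha'⟩ := hfs q0 hq0 hq0f
    refine ⟨a, fun φ hφ => ?_⟩
    by_cases h3 : φ = θ
    · exact h3 ▸ ha
    · have h4 : φ ∈ (fun φ => θ ⊓ g φ) '' q0 := by rw [h2]; exact ⟨hφ, h3⟩
      obtain ⟨ψ, hψ, rfl⟩ := h4
      exact Formula.realize_inf.2 ⟨ha, ha' ψ hψ⟩)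
  exact ⟨a, ha θ (Or.inr rfl),
    fun φ hφ => (Formula.realize_inf.1 (ha _ (Or.inl ⟨φ, hφ, rfl⟩))).2⟩

/-- The image of an elementary embedding is closed under witnesses. -/
theorem exists_witness_mem_range {M N : Type u} [L.Structure M] [L.Structure N] (f : M ↪ₑ[L] N)
    (n : ℕ) (φ : L.Formula (Fin n ⊕ Unit)) (x : Fin n → N) (hx : ∀ i, x i ∈ Set.range f)
    (h : ∃ a, φ.Realize (Sum.elim x fun _ => a)) :
    ∃ a ∈ Set.range f, φ.Realize (Sum.elim x fun _ => a) := by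
  choose y hy using hx
  obtain rfl : (fun i => f (y i)) = x := funext hy
  have hs := sameType_elementaryEmbedding f y
  obtain ⟨a, ha⟩ := (hs.exists_iff (Set.finite_singleton φ)).2
    (h.imp fun a ha ψ hψ => by rw [Set.mem_singleton_iff.1 hψ]; exact ha)
  refine ⟨f a, ⟨a, rfl⟩, ?_⟩
  have := sameType_elementaryEmbedding f (Sum.elim y fun _ : Unit => a)
  have e : (fun b => f (Sum.elim y (fun _ : Unit => a) b)) =
      Sum.elim (fun i => f (y i)) fun _ => f a := by
    ext b; rcases b with b | b <;> rfl
  rw [e] at this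
  exact (this φ).1 (ha φ rfl)

theorem exists_elementarySubstructure_range {M N : Type u} [L.Structure M] [L.Structure N]
    (f : M ↪ₑ[L] N) : ∃ S : L.ElementarySubstructure N, (S : Set N) = Set.range f :=
  exists_elementarySubstructure_of_witnesses _ (exists_witness_mem_range f)

theorem RealizesSmallSets.of_range {κ : Cardinal.{u}} {M N : Type u} [L.Structure M]
    [L.Structure N] (h : RealizesSmallSets L κ M) (f : M ↪ₑ[L] N) (S : L.ElementarySubstructure N)
    (hS : (S : Set N) = Set.range f) : RealizesSmallSets L κ S := by
  intro α w p hp hfs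
  have hw : ∀ a, ∃ y, f y = (w a : N) := fun a => by
    have : (w a : N) ∈ (S : Set N) := (w a).2
    rwa [hS] at this
  choose y hy using hw
  have hmem : ∀ b, f b ∈ S := fun b => by
    have : f b ∈ (S : Set N) := hS ▸ ⟨b, rfl⟩
    exact this
  have key : ∀ (φ : L.Formula (α ⊕ Unit)) (b : M), φ.Realize (Sum.elim y fun _ => b) ↔
      φ.Realize (Sum.elim w fun _ => (⟨f b, hmem b⟩ : S)) := by
    intro φ b
    rw [← elementarySubstructure_realize_iff S φ,
      (sameType_elementaryEmbedding f (Sum.elim y fun _ : Unit => b)) φ]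
    refine iff_of_eq (congrArg _ ?_)
    ext x
    rcases x with x | x
    · exact hy x
    · rfl
  obtain ⟨a, ha⟩ := h α y p hp fun q hq hqf => by
    obtain ⟨a, ha⟩ := hfs q hq hqf
    obtain ⟨b, hb⟩ : ∃ b, f b = (a : N) := by
      have : (a : N) ∈ (S : Set N) := a.2
      rwa [hS] at this
    exact ⟨b, fun φ hφ => (key φ b).2 (by
      have : (⟨f b, hmem b⟩ : S) = a := Subtype.ext hb
      rw [this]; exact ha φ hφ)⟩
  exact ⟨_, fun φ hφ => (key φ a).1 (ha φ hφ)⟩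

/-- There is a tuple in `V` satisfying `ψ`. -/
noncomputable def exIn {k m : ℕ} (V : L.Formula Unit) (ψ : L.Formula (Fin k ⊕ Fin m)) :
    L.Formula (Fin m) :=
  Formula.iExs (Fin k)
    (Formula.iInf (fun i : Fin k => V.relabel fun _ => Sum.inr i) ⊓ ψ.relabel Sum.swap)

theorem realize_exIn {k m : ℕ} {V : L.Formula Unit} {ψ : L.Formula (Fin k ⊕ Fin m)} {M : Type*}
    [L.Structure M] {b : Fin m → M} : (exIn V ψ).Realize b ↔
      ∃ a : Fin k → M, (∀ i, V.Realize fun _ => a i) ∧ ψ.Realize (Sum.elim a b) := by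
  rw [exIn, Formula.realize_iExs]
  refine exists_congr fun a => ?_
  rw [Formula.realize_inf, Formula.realize_iInf, Formula.realize_relabel]
  simp only [Formula.realize_relabel]
  refine and_congr Iff.rfl (iff_of_eq (congrArg _ ?_))
  ext x
  rcases x with x | x <;> rfl

/-- Every formula with parameters from `U` which is satisfied in `V` is satisfied in `W`. -/
def WitnessedIn {M : Type u} [L.Structure M] {k m : ℕ} (U V W : Set M)
    (ψ : L.Formula (Fin k ⊕ Fin m)) : Prop :=
  ∀ b : Fin m → M, (∀ i, b i ∈ U) → (∃ a : Fin k → M, (∀ i, a i ∈ V) ∧ ψ.Realize (Sum.elim a b)) →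
    ∃ a : Fin k → M, (∀ i, a i ∈ W) ∧ ψ.Realize (Sum.elim a b)

/-- With `U`, `V`, `W` defined by formulas, the condition is a single sentence. The first-order
properties of a pair are all carried over through it. -/
theorem WitnessedIn.transfer {M N : Type u} [L.Structure M] [L.Structure N] (h : M ≅[L] N)
    {k m : ℕ} (U V W : L.Formula Unit) (ψ : L.Formula (Fin k ⊕ Fin m))
    (hM : WitnessedIn {x : M | U.Realize fun _ => x} {x | V.Realize fun _ => x}
      {x | W.Realize fun _ => x} ψ) :
    WitnessedIn {x : N | U.Realize fun _ => x} {x | V.Realize fun _ => x}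
      {x | W.Realize fun _ => x} ψ := by
  let θ : L.Formula (Fin m) :=
    (Formula.iInf (fun i : Fin m => U.relabel fun _ => i)).imp ((exIn V ψ).imp (exIn W ψ))
  have key : ∀ (K : Type u) [L.Structure K],
      ((θ.relabel Sum.inr : L.Formula (Empty ⊕ Fin m)).iAlls (Fin m)).Realize
        (fun x : Empty => (x.elim : K)) ↔
      WitnessedIn {x : K | U.Realize fun _ => x} {x | V.Realize fun _ => x}
        {x | W.Realize fun _ => x} ψ := by
    intro K _
    rw [Formula.realize_iAlls]
    refine forall_congr' fun b => ?_
    rw [Formula.realize_relabel, Sum.elim_comp_inr]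
    simp only [θ, Formula.realize_imp, Formula.realize_iInf, realize_exIn, Formula.realize_relabel]
    rfl
  exact (key N).1 ((sameType_of_elementarilyEquivalent h _ _ _).1 ((key M).2 hM))

/-- The language with two unary predicates. -/
def pairLang : FirstOrder.Language.{u, u} where
  Functions := fun _ => PEmpty
  Relations := fun n => ULift {_b : Bool // n = 1}

/-- The expansion by two subsets. -/
@[reducible] def pairStructure {N : Type u} (Q R : Set N) : pairLang.{u}.Structure N where
  funMap := fun f _ => PEmpty.elim f
  RelMap := fun r x => x ⟨0, by have := r.down.2; omega⟩ ∈ bif r.down.1 then Q else R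

/-- The atomic formulas of the two predicates. -/
def pairFormula (L : FirstOrder.Language.{u, u}) (b : Bool) : (L.sum pairLang.{u}).Formula Unit :=
  Relations.formula₁ (L := L.sum pairLang.{u}) (Sum.inr ⟨b, rfl⟩) (Term.var ())

theorem card_sum_pairLang_lt {κ : Cardinal.{u}} (hL : max L.card ℵ₀ < κ) :
    max (L.sum pairLang.{u}).card ℵ₀ < κ := by
  have h1 : pairLang.{u}.card ≤ ℵ₀ := by
    have h2 : Countable pairLang.{u}.Symbols := by
      have : ∀ l, Countable (pairLang.{u}.Functions l) := fun l =>
        inferInstanceAs (Countable PEmpty)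
      have : ∀ l, Countable (pairLang.{u}.Relations l) := fun l =>
        inferInstanceAs (Countable (ULift {_b : Bool // l = 1}))
      exact inferInstanceAs (Countable ((Σ l, pairLang.{u}.Functions l) ⊕
        Σ l, pairLang.{u}.Relations l))
    exact mk_le_aleph0_iff.2 h2
  have h3 : ℵ₀ ≤ κ := (le_max_right _ _).trans hL.le
  have h4 : ℵ₀ < κ := (le_max_right _ _).trans_lt hL
  refine max_lt ?_ h4
  rw [card_sum, lift_id, lift_id]
  exact add_lt_of_lt h3 ((le_max_left _ _).trans_lt hL) (h1.trans_lt h4)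

/-- A proper extension of the model `M` inside `K` to a complete set with the same `P`-part, in
saturated form. -/
structure SaturatedPair (T : L.Theory) (P : L.Relations 1) (κ : Cardinal.{u}) where
  K : Theory.ModelType.{u, u, u} T
  M : L.ElementarySubstructure K
  A : Set K
  subset : (M : Set K) ⊆ A
  c : K
  mem : c ∈ A
  notMem : c ∉ M
  witnessed : ∀ {k m : ℕ} (ψ : L.Formula (Fin k ⊕ Fin m)),
    WitnessedIn A (pPart P K) (pPart P K ∩ M) ψ
  card_le : #K ≤ κ
  saturated : RealizesSmallSets L κ M
  saturatedP : RealizesSmallPSets P κ fun a : A => (a : K)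

/-- Name `M` and `A` by predicates, take a saturated model of the complete theory of the expansion,
and read the properties off there. -/
theorem exists_saturatedPair (T : L.Theory) (P : L.Relations 1) {κ : Cardinal.{u}}
    (hL : max L.card ℵ₀ < κ) (hκ : κ.IsRegular) (hpow : ∀ ν < κ, κ ^ ν ≤ κ)
    (N : Theory.ModelType.{u, u, u} T) (M : L.ElementarySubstructure N) (A : Set N)
    (hMA : (M : Set N) ⊆ A) (c : N) (hcA : c ∈ A) (hcM : c ∉ M)
    (hA : ∀ {k m : ℕ} (ψ : L.Formula (Fin k ⊕ Fin m)),
      WitnessedIn A (pPart P N) (pPart P N ∩ M) ψ) :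
    Nonempty (SaturatedPair T P κ) := by
  let _ : pairLang.{u}.Structure N := pairStructure M A
  let L' := L.sum pairLang.{u}
  let J : L →ᴸ L' := LHom.sumInl
  obtain ⟨K, hsat, hcard⟩ := exists_realizesSmallSets (L'.completeTheory N)
    (completeTheory.isSatisfiable L' N) le_rfl (card_sum_pairLang_lt hL) hκ hpow
  have hNK : N ≅[L'] K :=
    (completeTheory.isComplete L' N).models_elementarily_equivalent N K
  let _ : L.Structure K := J.reduct K
  have : J.IsExpansionOn K := LHom.isExpansionOn_reduct _ _
  have hKT : K ⊨ T := ⟨fun φ hφ => by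
    have h1 : N ⊨ φ := Theory.realize_sentence_of_mem T hφ
    rw [← LHom.realize_onSentence K J φ, ← elementarilyEquivalent_iff.1 hNK,
      LHom.realize_onSentence]
    exact h1⟩
  let K' : Theory.ModelType.{u, u, u} T := Theory.ModelType.of T K
  let Q : Set K := {x | (pairFormula L true).Realize fun _ => x}
  let R : Set K := {x | (pairFormula L false).Realize fun _ => x}
  have hQN : {x : N | (pairFormula L true).Realize fun _ => x} = M := by
    ext x
    simp only [pairFormula, Set.mem_ofPred_eq]
    rfl
  have hRN : {x : N | (pairFormula L false).Realize fun _ => x} = A := by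
    ext x
    simp only [pairFormula, Set.mem_ofPred_eq]
    rfl
  let Pf : L'.Formula Unit := J.onFormula (P.formula₁ (Term.var ()))
  have hPK : {x : K | Pf.Realize fun _ => x} = pPart P K := by
    ext x
    simp only [Pf, Set.mem_ofPred_eq, LHom.realize_onFormula, Formula.realize_rel₁]
    rfl
  have hPN : {x : N | Pf.Realize fun _ => x} = pPart P N := by
    ext x
    simp only [Pf, Set.mem_ofPred_eq, LHom.realize_onFormula, Formula.realize_rel₁]
    rfl
  have htop : ∀ (B : Type u) [L'.Structure B],
      {x : B | (⊤ : L'.Formula Unit).Realize fun _ => x} = Set.univ := by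
    intro B _; ext x; simp [Formula.realize_top]
  have hinf : ∀ (B : Type u) [L'.Structure B] (V W : L'.Formula Unit),
      {x : B | (V ⊓ W).Realize fun _ => x} =
        {x : B | V.Realize fun _ => x} ∩ {x : B | W.Realize fun _ => x} := by
    intro B _ V W; ext x; simp [Formula.realize_inf]
  -- transfer to `K`
  have hwit : ∀ {k m : ℕ} (ψ : L.Formula (Fin k ⊕ Fin m)),
      WitnessedIn R (pPart P K) (pPart P K ∩ Q) ψ := by
    intro k m ψ
    have h1 := WitnessedIn.transfer hNK (pairFormula L false) Pf (Pf ⊓ pairFormula L true)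
      (J.onFormula ψ) (by
        rw [hinf, hRN, hPN, hQN]
        simpa only [WitnessedIn, LHom.realize_onFormula] using hA ψ)
    rw [hinf, hPK] at h1
    simpa only [WitnessedIn, LHom.realize_onFormula] using h1
  -- With `V` everything and `W = Q`, this is the Tarski–Vaught criterion for `Q`.
  have hQel : ∀ {m : ℕ} (ψ : L.Formula (Fin 1 ⊕ Fin m)),
      WitnessedIn Q (Set.univ : Set K) Q ψ := by
    intro m ψ
    have h1 := WitnessedIn.transfer hNK (pairFormula L true) ⊤ (pairFormula L true)
      (J.onFormula ψ) (by
        rw [htop, hQN]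
        simp only [WitnessedIn, LHom.realize_onFormula]
        rintro b hb ⟨a, -, ha⟩
        have key : ∀ d : Fin 1 → N, ψ.Realize (Sum.elim d b) ↔
            (ψ.relabel (Sum.elim (fun _ => Sum.inr ()) Sum.inl) : L.Formula (Fin m ⊕ Unit)).Realize
              (Sum.elim b fun _ => d 0) := by
          intro d
          rw [Formula.realize_relabel]
          refine iff_of_eq (congrArg _ ?_)
          ext x
          rcases x with x | x
          · simp [Subsingleton.elim x 0]
          · rfl
        have hr : Set.range M.subtype = (M : Set N) := by simp
        obtain ⟨d, hd, hd'⟩ := exists_witness_mem_range M.subtype m _ b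
          (fun i => by rw [hr]; exact hb i) ⟨a 0, (key a).1 ha⟩
        rw [hr] at hd
        exact ⟨fun _ => d, fun _ => hd, (key fun _ => d).2 hd'⟩)
    rw [htop] at h1
    simpa only [WitnessedIn, LHom.realize_onFormula] using h1
  -- Inclusion is coded as a witness condition for the formula `x = y`.
  have hQR : Q ⊆ R := by
    intro x hx
    let ψ : L'.Formula (Fin 1 ⊕ Fin 1) := Term.equal (Term.var (Sum.inl 0)) (Term.var (Sum.inr 0))
    have h1 := WitnessedIn.transfer hNK (pairFormula L true) ⊤ (pairFormula L false) ψ (by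
        rw [htop, hQN, hRN]
        rintro b hb ⟨a, -, ha⟩
        simp only [ψ, Formula.realize_equal, Term.realize_var, Sum.elim_inl, Sum.elim_inr] at ha
        exact ⟨b, fun i => hMA (hb i), by simp [ψ, Formula.realize_equal]⟩)
    obtain ⟨a, ha, ha'⟩ := h1 (fun _ => x) (fun _ => hx)
      ⟨fun _ => x, by rw [htop]; simp, by simp [ψ, Formula.realize_equal]⟩
    simp only [ψ, Formula.realize_equal, Term.realize_var, Sum.elim_inl, Sum.elim_inr] at ha'
    exact ha' ▸ ha 0
  -- Nonemptiness of `R` minus `Q` is coded by a trivial formula without parameters.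
  obtain ⟨c', hc'R, hc'Q⟩ : ∃ c' ∈ R, c' ∉ Q := by
    have h1 := WitnessedIn.transfer hNK (k := 1) (m := 0) ⊤ ⊤
      (pairFormula L false ⊓ (pairFormula L true).not) ⊤ (by
        rintro b - -
        refine ⟨fun _ => c, fun _ => ?_, by simp [Formula.realize_top]⟩
        simp only [Set.mem_ofPred_eq, Formula.realize_inf, Formula.realize_not]
        exact ⟨hRN.ge hcA, fun h => hcM (hQN.le h)⟩)
    obtain ⟨a, ha, -⟩ := h1 Fin.elim0 (fun i => i.elim0)
      ⟨fun _ => Classical.arbitrary K, by rw [htop]; simp, by simp [Formula.realize_top]⟩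
    have h2 := ha 0
    simp only [Set.mem_ofPred_eq, Formula.realize_inf, Formula.realize_not] at h2
    exact ⟨a 0, h2⟩
  obtain ⟨M', hM'⟩ := exists_elementarySubstructure_of_witnesses (L := L) Q (by
    intro n φ x hx ⟨a, ha⟩
    have key : ∀ d : Fin 1 → K,
        (φ.relabel (Sum.elim Sum.inr fun _ => Sum.inl 0) : L.Formula (Fin 1 ⊕ Fin n)).Realize
          (Sum.elim d x) ↔ φ.Realize (Sum.elim x fun _ => d 0) := by
      intro d
      rw [Formula.realize_relabel]
      refine iff_of_eq (congrArg _ ?_)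
      ext y
      rcases y with y | y <;> rfl
    obtain ⟨d, hd, hd'⟩ := hQel _ x hx ⟨fun _ => a, fun _ => trivial, (key _).2 ha⟩
    exact ⟨d 0, hd 0, (key d).1 hd'⟩)
  have hκ0 := hκ.aleph0_le
  have hmem : ∀ x, x ∈ M' ↔ x ∈ Q := fun x => Set.ext_iff.1 hM' x
  have hwit' : ∀ {k m : ℕ} (ψ : L.Formula (Fin k ⊕ Fin m)),
      WitnessedIn R (pPart P K) (pPart P K ∩ M') ψ := by
    intro k m ψ
    rw [hM']
    exact hwit ψ
  have hS : RealizesSmallSets L κ M' := by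
    intro α w p hp hfs
    have key : ∀ (φ : L.Formula (α ⊕ Unit)) (a : M'),
        (J.onFormula φ).Realize (Sum.elim (fun a => (w a : K)) fun _ => (a : K)) ↔
          φ.Realize (Sum.elim w fun _ => a) := by
      intro φ a
      rw [LHom.realize_onFormula]
      refine Iff.trans (iff_of_eq (congrArg _ ?_))
        (elementarySubstructure_realize_iff M' φ (Sum.elim w fun _ => a))
      ext x
      rcases x with x | x <;> rfl
    have keyQ : ∀ a : K, ((pairFormula L true).relabel Sum.inr : L'.Formula (α ⊕ Unit)).Realize
        (Sum.elim (fun a => (w a : K)) fun _ => (a : K)) ↔ a ∈ Q := by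
      intro a
      rw [Formula.realize_relabel]
      rfl
    obtain ⟨a, haQ, ha⟩ := hsat.exists_and hκ0 (fun a => (w a : K))
      ((pairFormula L true).relabel Sum.inr) p J.onFormula hp (by
        intro q hq hqf
        obtain ⟨a, ha⟩ := hfs q hq hqf
        exact ⟨a, (keyQ _).2 ((hmem _).1 a.2), fun φ hφ => (key φ a).2 (ha φ hφ)⟩)
    exact ⟨⟨a, (hmem _).2 ((keyQ a).1 haQ)⟩, fun φ hφ => (key φ ⟨a, _⟩).1 (ha φ hφ)⟩
  -- Completeness moves a solution of a finite part from `P` into `P ∩ Q`; saturation of the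
  -- expansion then realizes the whole set in `P ∩ Q`, hence in `R`.
  have hSP : RealizesSmallPSets P κ fun a : R => (a : K) := by
    intro p hp hfs
    have keyQ : ∀ a : K, ((Pf ⊓ pairFormula L true).relabel Sum.inr :
        L'.Formula (R ⊕ Unit)).Realize
        (Sum.elim (fun a => (a : K)) fun _ => a) ↔ a ∈ pPart P K ∩ Q := by
      intro a
      rw [Formula.realize_relabel, Formula.realize_inf, ← hPK]
      rfl
    obtain ⟨a, haQ, ha⟩ := hsat.exists_and hκ0 (fun a : R => (a : K))
      ((Pf ⊓ pairFormula L true).relabel Sum.inr) p J.onFormula hp (by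
        intro q hq hqf
        obtain ⟨d, hd, hdq⟩ := hfs q hq hqf
        obtain ⟨m, x, φ', hφ'⟩ := exists_formula_fin (finConj q hqf)
        have key : ∀ d : Fin 1 → K,
            (φ'.relabel (Sum.elim Sum.inr fun _ => Sum.inl 0) : L.Formula (Fin 1 ⊕ Fin m)).Realize
              (Sum.elim d fun i => (x i : K)) ↔
            ∀ φ ∈ q, φ.Realize (Sum.elim (fun a : R => (a : K)) fun _ => d 0) := by
          intro d
          rw [Formula.realize_relabel, ← realize_finConj (hq := hqf), ← hφ']
          refine iff_of_eq (congrArg _ ?_)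
          ext y
          rcases y with y | y <;> rfl
        obtain ⟨d', hd', hd'q⟩ := hwit _ (fun i => (x i : K)) (fun i => (x i).2)
          ⟨fun _ => d, fun _ => hd, (key fun _ => d).2 hdq⟩
        refine ⟨d' 0, (keyQ _).2 (hd' 0), fun φ hφ => ?_⟩
        rw [LHom.realize_onFormula]
        exact (key d').1 hd'q φ hφ)
    refine ⟨⟨a, hQR ((keyQ a).1 haQ).2⟩, fun φ hφ => ?_⟩
    exact (LHom.realize_onFormula J φ).1 (ha φ hφ)
  exact ⟨⟨K', M', R, hM'.le.trans hQR, c', hc'R, fun h => hc'Q ((hmem _).1 h), hwit', hcard, hS,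
    hSP⟩⟩

end Pairs

/-! ### Relativization to `P` -/

section Relativize

variable {L : FirstOrder.Language.{u, u}}

/-- Terms of the relational part are variables. -/
def relTerm {β : Type*} : (relPart L).Term β → L.Term β
  | Term.var x => Term.var x
  | Term.func f _ => PEmpty.elim f

theorem realize_relTerm {β : Type*} {M : Type u} [L.Structure M] (P : L.Relations 1)
    (t : (relPart L).Term β) (v : β → pPart P M) :
    (relTerm t).realize (fun b => (v b : M)) = ((t.realize v : pPart P M) : M) := by
  cases t with
  | var x => rfl
  | func f _ => exact PEmpty.elim f

/-- Relativization of the quantifiers to `P`. -/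
def relativize {α : Type*} (P : L.Relations 1) :
    ∀ {n : ℕ}, (relPart L).BoundedFormula α n → L.BoundedFormula α n
  | _, BoundedFormula.falsum => BoundedFormula.falsum
  | _, BoundedFormula.equal t s => BoundedFormula.equal (relTerm t) (relTerm s)
  | _, @BoundedFormula.rel _ _ _ l R ts =>
      BoundedFormula.rel (show L.Relations l from R) fun i => relTerm (ts i)
  | _, BoundedFormula.imp φ ψ => (relativize P φ).imp (relativize P ψ)
  | n, BoundedFormula.all φ =>
      ((P.boundedFormula₁ (Term.var (Sum.inr (Fin.last n)))).imp (relativize P φ)).all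

theorem realize_relativize {α : Type*} (P : L.Relations 1) {M : Type u} [L.Structure M] {n : ℕ}
    (φ : (relPart L).BoundedFormula α n) (v : α → pPart P M) (xs : Fin n → pPart P M) :
    (relativize P φ).Realize (fun a => (v a : M)) (fun i => (xs i : M)) ↔ φ.Realize v xs := by
  induction φ with
  | falsum => rfl
  | equal t s =>
    have e : (Sum.elim (fun a => (v a : M)) fun i => (xs i : M)) =
        fun b => ((Sum.elim v xs b : pPart P M) : M) := by ext b; rcases b with b | b <;> rfl
    simp only [relativize, BoundedFormula.Realize, e, realize_relTerm, Subtype.coe_inj]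
  | rel R ts =>
    have e : (Sum.elim (fun a => (v a : M)) fun i => (xs i : M)) =
        fun b => ((Sum.elim v xs b : pPart P M) : M) := by ext b; rcases b with b | b <;> rfl
    simp only [relativize, BoundedFormula.Realize, e, realize_relTerm]
    rfl
  | imp φ ψ ih1 ih2 => simp only [relativize, BoundedFormula.realize_imp, ih1, ih2]
  | all φ ih =>
    simp only [relativize, BoundedFormula.realize_all, BoundedFormula.realize_imp,
      BoundedFormula.realize_rel₁]
    have key : ∀ a : pPart P M, (fun i => ((Fin.snoc xs a : Fin (_ + 1) → pPart P M) i : M)) =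
        Fin.snoc (fun i => (xs i : M)) (a : M) := by
      intro a
      ext i
      refine Fin.lastCases ?_ (fun i => ?_) i <;> simp
    constructor
    · intro h a
      rw [← ih, key]
      refine h a ?_
      simpa [pPart] using a.2
    · intro h a ha
      have ha' : a ∈ pPart P M := by simpa [pPart] using ha
      rw [← key ⟨a, ha'⟩, ih]
      exact h _

/-- Relativizing quantifiers turns a type of the induced structure into a type of `M` containing
`P(x)`. -/
theorem hasSaturatedPPart_of_isKSaturated {P : L.Relations 1} {M : Type u} [L.Structure M]
    (h : IsKSaturated L #(pPart P M) M) : HasSaturatedPPart P M := by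
  intro B hB p hfs
  -- For empty `p` no translated formula would force the realization into `P`.
  rcases p.eq_empty_or_nonempty with rfl | ⟨φ0, hφ0⟩
  · obtain ⟨a, -⟩ := hfs ∅ subset_rfl Set.finite_empty
    exact ⟨a, by simp⟩
  let B' : Set M := Subtype.val '' B
  let ρ : B → B' := fun b => ⟨b.1, b.1, b.2, rfl⟩
  let τ : (relPart L).Formula (B ⊕ Unit) → L.Formula (B' ⊕ Unit) := fun φ =>
    P.formula₁ (Term.var (Sum.inr ())) ⊓ Formula.relabel (Sum.map ρ id) (relativize P φ)
  have hτ : ∀ (φ : (relPart L).Formula (B ⊕ Unit)) (a : pPart P M),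
      (Formula.relabel (Sum.map ρ id) (relativize P φ) : L.Formula (B' ⊕ Unit)).Realize
        (Sum.elim (fun b : B' => (b : M)) fun _ => (a : M)) ↔
        φ.Realize (Sum.elim (fun b : B => (b : pPart P M)) fun _ => a) := by
    intro φ a
    rw [Formula.realize_relabel, Formula.Realize, Formula.Realize, ← realize_relativize]
    have e1 : (Sum.elim (fun b : B' => (b : M)) fun _ => (a : M)) ∘ Sum.map ρ id =
      fun x : B ⊕ Unit => ((Sum.elim (fun b : B => (b : pPart P M)) (fun _ => a) x : pPart P M) : M)
      := by ext x; rcases x with x | x <;> rfl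
    rw [e1, Unique.eq_default (fun i : Fin 0 => ((default : Fin 0 → pPart P M) i : M))]
  have hP : ∀ a : M, ((P.formula₁ (Term.var (Sum.inr ())) : L.Formula (B' ⊕ Unit)).Realize
      (Sum.elim (fun b : B' => (b : M)) fun _ => (a : M)) ↔ a ∈ pPart P M) := by
    intro a
    simp [Formula.realize_rel₁, pPart]
  obtain ⟨a, ha⟩ := h B' (mk_image_le.trans_lt hB) (τ '' p) (by
    intro q hq hqf
    obtain ⟨q0, hq0, hq0f, rfl⟩ := Set.exists_subset_image_finite_and.1 ⟨q, hq, hqf, rfl⟩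
    obtain ⟨a, ha⟩ := hfs q0 hq0 hq0f
    refine ⟨a, ?_⟩
    rintro _ ⟨φ, hφ, rfl⟩
    exact Formula.realize_inf.2 ⟨(hP a).2 a.2, (hτ φ a).2 (ha φ hφ)⟩)
  have haP : a ∈ pPart P M := (hP a).1 (Formula.realize_inf.1 (ha _ ⟨φ0, hφ0, rfl⟩)).1
  exact ⟨⟨a, haP⟩, fun φ hφ =>
    (hτ φ ⟨a, haP⟩).1 (Formula.realize_inf.1 (ha _ ⟨φ, hφ, rfl⟩)).2⟩

end Relativize

/-! ### Consequences of the existence of a saturated pair -/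

section SaturatedPairs

variable {L : FirstOrder.Language.{u, u}} {T : L.Theory} {P : L.Relations 1} {κ : Cardinal.{u}}

/-- Otherwise "`x` is in `P` and differs from every point of `P^M`" would be a small set, finitely
satisfiable since `P^M` is infinite. -/
theorem RealizesSmallSets.le_mk_pPart {M : Type u} [L.Structure M] (h : RealizesSmallSets L κ M)
    (hκ : ℵ₀ ≤ κ) (hP : (pPart P M).Infinite) : κ ≤ #(pPart P M) := by
  by_contra! hlt
  obtain ⟨a, ha, ha'⟩ := h.exists_and hκ (fun b : pPart P M => (b : M))
    (P.formula₁ (Term.var (Sum.inr ()))) Set.univ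
    (fun b => (Term.equal (Term.var (Sum.inr ())) (Term.var (Sum.inl b)) :
      L.Formula (pPart P M ⊕ Unit)).not) (by rwa [mk_univ]) (by
      intro q _ hq
      obtain ⟨a, ha, ha'⟩ := hP.exists_notMem_finite (hq.image Subtype.val)
      refine ⟨a, by simpa [Formula.realize_rel₁, pPart] using ha, fun b hb => ?_⟩
      simp only [Formula.realize_not, Formula.realize_equal, Term.realize_var, Sum.elim_inl,
        Sum.elim_inr]
      exact fun hab => ha' ⟨b, hb, hab.symm⟩)
  have haP : a ∈ pPart P M := by simpa [Formula.realize_rel₁, pPart] using ha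
  have := ha' ⟨a, haP⟩ trivial
  simp [Formula.realize_not, Formula.realize_equal] at this

theorem not_isAlgebraicType_typeOver {N : Type u} [L.Structure N] (M : L.ElementarySubstructure N)
    {c : N} (hc : c ∉ M) : ¬ IsAlgebraicType (typeOver M.subtype fun _ : Fin 1 => c) := by
  rintro ⟨a, ha⟩
  let φ : L.Formula (M ⊕ Fin 1) := Term.equal (Term.var (Sum.inr 0)) (Term.var (Sum.inl (a 0)))
  have h1 : φ ∈ typeOver (ElementaryEmbedding.refl L M) a := by
    change φ.Realize _
    simp [φ, Formula.realize_equal]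
  have h2 : φ ∈ typeOver M.subtype fun _ => c := ha.ge h1
  have h3 : c = (a 0 : M) := by
    have : φ.Realize (Sum.elim (⇑M.subtype) fun _ : Fin 1 => c) := h2
    simpa [φ, Formula.realize_equal] using this
  exact hc (h3 ▸ (a 0 : M).2)

/-- A non-algebraic tuple has a coordinate outside `M`; since `M ∪ c` has no new points of `P`, its
completeness yields witnesses in `M`. -/
theorem exists_saturatedPair_of_not_nulldimensional (hT : ¬ Nulldimensional T P)
    (hL : max L.card ℵ₀ < κ) (hκ : κ.IsRegular) (hpow : ∀ ν < κ, κ ^ ν ≤ κ) :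
    Nonempty (SaturatedPair T P κ) := by
  simp only [Nulldimensional, not_forall] at hT
  obtain ⟨M, n, p, ⟨N, _, f, c, rfl, hP, hc⟩, halg⟩ := hT
  have : N ⊨ T := (f.theory_model_iff T).1 inferInstance
  have : Nonempty N := ⟨f (Classical.arbitrary M)⟩
  obtain ⟨S, hS⟩ := exists_elementarySubstructure_range f
  obtain ⟨i, hi⟩ : ∃ i, c i ∉ Set.range f := by
    by_contra! h
    choose a ha using h
    refine halg ⟨a, ?_⟩
    ext φ
    have e : (Sum.elim (⇑f) c) = fun x => f (Sum.elim id a x) := by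
      ext x
      rcases x with x | x
      · rfl
      · exact (ha x).symm
    change φ.Realize (Sum.elim f c) ↔ φ.Realize (Sum.elim id a)
    rw [e]
    exact f.map_formula φ _
  have hmem : ∀ x, x ∈ S ↔ x ∈ Set.range f := fun x => Set.ext_iff.1 hS x
  refine exists_saturatedPair T P hL hκ hpow (Theory.ModelType.of T N) S
    (Set.range f ∪ Set.range c) (hS.le.trans Set.subset_union_left) (c i) (Or.inr ⟨i, rfl⟩)
    (fun h => hi ((hmem _).1 h)) ?_
  intro k m ψ b hb hex
  obtain ⟨a, ha, ha'⟩ := hc k m ψ b hb hex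
  rw [hP] at ha
  exact ⟨a, fun j => ⟨(ha j).1, (hmem _).2 (ha j).2⟩, ha'⟩

namespace SaturatedPair

variable (D : SaturatedPair T P κ)

/-- Apply completeness to the formula `y = x` with parameter `x` itself. -/
theorem mem_of_mem_pPart {x : D.K} (hx : x ∈ pPart P D.K) (hA : x ∈ D.A) : x ∈ D.M := by
  obtain ⟨a, ha, ha'⟩ := D.witnessed
    (Term.equal (Term.var (Sum.inl 0)) (Term.var (Sum.inr 0)) : L.Formula (Fin 1 ⊕ Fin 1))
    (fun _ => x) (fun _ => hA) ⟨fun _ => x, fun _ => hx, by simp [Formula.realize_equal]⟩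
  have h : a 0 = x := by simpa [Formula.realize_equal] using ha'
  exact h ▸ (ha 0).2

theorem infinite_pPart (hT : IsTheoryOverP T P) : (pPart P D.M).Infinite :=
  hT.infinite (Theory.ModelType.of T D.M)

theorem mk_le : #D.M ≤ κ := (mk_set_le (D.M : Set D.K)).trans D.card_le

theorem mk_eq (hT : IsTheoryOverP T P) (hκ : ℵ₀ ≤ κ) : #D.M = κ :=
  D.mk_le.antisymm ((D.saturated.le_mk_pPart hκ (D.infinite_pPart hT)).trans (mk_set_le _))

/-- Witnesses for parameters in `A` lie in `P ∩ M`, so the smaller set `M ∪ {c}` is complete too. As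
`M` has size exactly `κ`, it is saturated in its own cardinality. -/
theorem exists_nonalgebraic (D : SaturatedPair T P κ) (hT : IsTheoryOverP T P) (hL : max L.card ℵ₀ < κ) (hκ : ℵ₀ ≤ κ) :
    ∃ M : Theory.ModelType.{u, u, u} T, IsSaturated L M ∧
      ∃ (n : ℕ) (p : Set (L.Formula (M ⊕ Fin n))), p ∈ starTypes P M n ∧
        ¬ IsAlgebraicType p := by
  have hsat : IsSaturated L D.M := by
    rw [IsSaturated, D.mk_eq hT hκ]
    exact D.saturated.isKSaturated hL
  refine ⟨Theory.ModelType.of T D.M, hsat, 1, typeOver D.M.subtype fun _ => D.c, ?_,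
    not_isAlgebraicType_typeOver D.M D.notMem⟩
  · have hsub : Set.range D.M.subtype ∪ Set.range (fun _ : Fin 1 => D.c) ⊆ D.A := by
      rintro x (⟨y, rfl⟩ | ⟨_, rfl⟩)
      · exact D.subset y.2
      · exact D.mem
    refine ⟨D.K, inferInstance, D.M.subtype, fun _ => D.c, rfl, ?_, ?_⟩
    · ext x
      refine ⟨fun ⟨hx, hx'⟩ => ⟨hx, ⟨⟨x, D.mem_of_mem_pPart hx (hsub hx')⟩, rfl⟩⟩,
        fun ⟨hx, hx'⟩ => ⟨hx, Or.inl hx'⟩⟩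
    · intro k m ψ b hb hex
      obtain ⟨a, ha, ha'⟩ := D.witnessed ψ b (fun i => hsub (hb i)) hex
      exact ⟨a, fun i => ⟨(ha i).1, Or.inl ⟨⟨a i, (ha i).2⟩, rfl⟩⟩, ha'⟩

/-- The model `M` of a saturated pair has a proper elementary self-embedding covering `P`. -/
theorem exists_selfEmbedding (hL : max L.card ℵ₀ < κ) (hκ : κ.IsRegular) :
    ∃ f : D.M ↪ₑ[L] D.M, (∀ y ∈ pPart P D.M, y ∈ Set.range f) ∧ ∃ y, y ∉ Set.range f := by
  -- The target is `M` itself, which is saturated and elementarily equivalent to the ambient model.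
  obtain ⟨F, hF, hFP⟩ := exists_sameType_covering (P := P) (v := fun a : D.A => (a : D.K)) hκ hL
    D.M.elementarilyEquivalent.symm D.saturated D.mk_le ((mk_set_le _).trans D.card_le)
    D.saturatedP
  let inc : D.M → D.A := fun x => ⟨x, D.subset x.2⟩
  have h1 : SameType L (fun x : D.M => (x : D.K)) fun x => F (inc x) := hF.comp inc
  have h2 : SameType L (id : D.M → D.M) fun x => F (inc x) :=
    (sameType_elementaryEmbedding D.M.subtype id).trans h1
  obtain ⟨f, hf⟩ := SameType.exists_elementaryEmbedding h2
  refine ⟨f, fun y hy => ?_, F ⟨D.c, D.mem⟩, ?_⟩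
  · obtain ⟨a, rfl⟩ := hFP y hy
    have haP : (a : D.K) ∈ pPart P D.K := (hF.rel₁_iff P a).2 hy
    exact ⟨⟨a, D.mem_of_mem_pPart haP a.2⟩, hf _⟩
  · rintro ⟨x, hx⟩
    rw [hf] at hx
    have h3 : (x : D.K) = D.c := (hF.eq_iff (inc x) ⟨D.c, D.mem⟩).2 hx
    exact D.notMem (h3 ▸ x.2)

theorem exists_vaughtianPair (D : SaturatedPair T P κ) (hT : IsTheoryOverP T P) (hL : max L.card ℵ₀ < κ)
    (hκ : κ.IsRegular) :
    ∃ (N : Theory.ModelType.{u, u, u} T) (M : L.ElementarySubstructure N),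
      IsVaughtianPair P M ∧ HasSaturatedPPart P M ∧ #(pPart P M) = κ := by
  obtain ⟨f, hfP, y, hy⟩ := D.exists_selfEmbedding hL hκ
  obtain ⟨S, hS⟩ := exists_elementarySubstructure_range f
  have hsat : RealizesSmallSets L κ S := D.saturated.of_range f S hS
  have hinf : (pPart P S).Infinite := hT.infinite (Theory.ModelType.of T S)
  have hcard : #(pPart P S) = κ :=
    ((mk_set_le _).trans ((mk_set_le (S : Set D.M)).trans D.mk_le)).antisymm
      (hsat.le_mk_pPart hκ.aleph0_le hinf)
  have hvp : IsVaughtianPair P S := by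
    refine ⟨fun h => hy (hS ▸ h ▸ Set.mem_univ y), ?_⟩
    have hP : ∀ x : S, x ∈ pPart P S ↔ (x : D.M) ∈ pPart P D.M := fun x =>
      (sameType_elementaryEmbedding S.subtype id).rel₁_iff P x
    ext z
    constructor
    · rintro ⟨x, hx, rfl⟩
      exact (hP x).1 hx
    · intro hz
      have hzS : z ∈ (S : Set D.M) := hS ▸ hfP z hz
      exact ⟨⟨z, hzS⟩, (hP ⟨z, hzS⟩).2 hz, rfl⟩
  have hPs : HasSaturatedPPart P S := by
    apply hasSaturatedPPart_of_isKSaturated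
    rw [hcard]
    exact hsat.isKSaturated hL
  exact ⟨Theory.ModelType.of T D.M, S, hvp, hPs, hcard⟩

end SaturatedPair

end SaturatedPairs

/-! ### A long chain of extensions with the same `P`-part -/

section Chain

variable {L : FirstOrder.Language.{u, u}} {T : L.Theory} {P : L.Relations 1} {κ : Cardinal.{u}}

theorem mem_pPart_coe_iff {C : Type u} [L.Structure C] (S : L.ElementarySubstructure C) (x : S) :
    x ∈ pPart P S ↔ (x : C) ∈ pPart P C :=
  (sameType_elementaryEmbedding S.subtype id).rel₁_iff P x

theorem exists_elementarySubstructure_iUnion {C : Type u} [L.Structure C] {ι : Type*} [Nonempty ι]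
    (S : ι → L.ElementarySubstructure C) (hd : Directed (· ⊆ ·) fun i => (S i : Set C)) :
    ∃ U : L.ElementarySubstructure C, (U : Set C) = ⋃ i, (S i : Set C) := by
  refine exists_elementarySubstructure_of_witnesses _ fun n φ x hx hex => ?_
  choose i hi using fun k => Set.mem_iUnion.1 (hx k)
  obtain ⟨z, hz⟩ := hd.finite_le i
  have hr : Set.range (S z).subtype = (S z : Set C) := by simp
  obtain ⟨a, ha, ha'⟩ := exists_witness_mem_range (S z).subtype n φ x
    (fun k => by rw [hr]; exact hz k (hi k)) hex
  rw [hr] at ha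
  exact ⟨a, Set.mem_iUnion.2 ⟨z, ha⟩, ha'⟩

/-- In a model, formulas on `P` with arbitrary parameters are equivalent to formulas with parameters
from `P`. -/
theorem IsTheoryOverP.exists_formula_pPart (hT : IsTheoryOverP T P)
    (S : Theory.ModelType.{u, u, u} T) (φ : L.Formula (S ⊕ Unit)) :
    ∃ ψ : L.Formula (pPart P S ⊕ Unit), ∀ x : S,
      ψ.Realize (Sum.elim (fun d : pPart P S => (d : S)) fun _ => x) ↔
        x ∈ pPart P S ∧ φ.Realize (Sum.elim id fun _ => x) := by
  let D : Set (Fin 1 → S) := {y | y 0 ∈ pPart P S ∧ φ.Realize (Sum.elim id fun _ => y 0)}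
  have hD : (Set.univ : Set S).Definable L D := by
    rw [Set.definable_iff_exists_formula_sum]
    refine ⟨P.formula₁ (Term.var (Sum.inr 0)) ⊓
      φ.relabel (Sum.map (fun s => ⟨s, trivial⟩) fun _ => 0), ?_⟩
    ext y
    simp only [D, Set.mem_ofPred_eq, Formula.realize_inf, Formula.realize_relabel,
      Sum.elim_comp_map, Formula.realize_rel₁]
    rfl
  have h1 := hT.stablyEmbedded S 1 D
    (fun y hy i => by rw [Subsingleton.elim i 0]; exact hy.1) hD
  rw [Set.definable_iff_exists_formula_sum] at h1
  obtain ⟨ψ, hψ⟩ := h1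
  refine ⟨ψ.relabel (Sum.map id fun _ => ()), fun x => ?_⟩
  have h2 := Set.ext_iff.1 hψ fun _ => x
  simp only [D, Set.mem_ofPred_eq] at h2
  rw [h2, Formula.realize_relabel, Sum.elim_comp_map]
  rfl

/-- Stable embeddedness replaces parameters from `S` by parameters from `P^S`, which pull back along
`h` to the saturated `M`. No saturation of `S` is needed. -/
theorem realizesSmallPSets_of_pPart_eq (hT : IsTheoryOverP T P) (hκ : ℵ₀ ≤ κ) {M : Type u}
    [L.Structure M] (hM : RealizesSmallSets L κ M) (C : Theory.ModelType.{u, u, u} T)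
    (h : M ↪ₑ[L] C) (S : L.ElementarySubstructure C)
    (hS : pPart P C ∩ S = h '' pPart P M) :
    RealizesSmallPSets P κ (id : S → S) := by
  have hform : ∀ φ : L.Formula (S ⊕ Unit), ∃ ψ : L.Formula (pPart P S ⊕ Unit), ∀ x : S,
      ψ.Realize (Sum.elim (fun d : pPart P S => (d : S)) fun _ => x) ↔
        x ∈ pPart P S ∧ φ.Realize (Sum.elim id fun _ => x) :=
    hT.exists_formula_pPart (Theory.ModelType.of T S)
  choose g hg using hform
  have hw : ∀ d : pPart P S, ∃ y ∈ pPart P M, h y = ((d : S) : C) := fun d => by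
    have h1 : ((d : S) : C) ∈ pPart P C ∩ S := ⟨(mem_pPart_coe_iff S d.1).1 d.2, d.1.2⟩
    rw [hS] at h1
    exact h1
  choose w hwP hw using hw
  have key : ∀ (ψ : L.Formula (pPart P S ⊕ Unit)) (b : M) (x : S), h b = x →
      (ψ.Realize (Sum.elim w fun _ => b) ↔
        ψ.Realize (Sum.elim (fun d : pPart P S => (d : S)) fun _ => x)) := by
    intro ψ b x hbx
    rw [← elementarySubstructure_realize_iff S ψ, ← h.map_formula ψ]
    refine iff_of_eq (congrArg _ ?_)
    ext y
    rcases y with y | y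
    · exact hw y
    · exact hbx
  intro p hp hfs
  obtain ⟨b, hbP, hb⟩ := hM.exists_and hκ w (P.formula₁ (Term.var (Sum.inr ()))) p g hp (by
    intro q hq hqf
    obtain ⟨d, hd, hdq⟩ := hfs q hq hqf
    exact ⟨w ⟨d, hd⟩, Formula.realize_rel₁.2 (hwP ⟨d, hd⟩),
      fun φ hφ => (key _ _ d (hw ⟨d, hd⟩)).2 ((hg φ d).2 ⟨hd, hdq φ hφ⟩)⟩)
  have hbP' : b ∈ pPart P M := Formula.realize_rel₁.1 hbP
  have hbS : h b ∈ pPart P C ∩ S := hS.ge ⟨b, hbP', rfl⟩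
  exact ⟨⟨h b, hbS.2⟩, fun φ hφ => ((hg φ _).1 ((key _ b ⟨h b, hbS.2⟩ rfl).1 (hb φ hφ))).2⟩

/-- An elementary submodel of size at most `κ` of a `κ⁺`-saturated model whose `P`-part is
saturated properly extends to a saturated one with the same `P`-part. -/
theorem exists_proper_extension (hT : IsTheoryOverP T P) (hL : max L.card ℵ₀ < κ)
    (hκ : κ.IsRegular) {M : Type u} [L.Structure M] (hM : RealizesSmallSets L κ M) (hMκ : #M ≤ κ)
    (f : M ↪ₑ[L] M) (hfP : ∀ y ∈ pPart P M, y ∈ Set.range f) (hf : ∃ y, y ∉ Set.range f)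
    (C : Theory.ModelType.{u, u, u} T) (hC : RealizesSmallSets L (Order.succ κ) C)
    (h : M ↪ₑ[L] C) (S : L.ElementarySubstructure C) (hSκ : #S ≤ κ)
    (hS : pPart P C ∩ S = h '' pPart P M) :
    ∃ S' : L.ElementarySubstructure C, #S' ≤ κ ∧ pPart P C ∩ S' = h '' pPart P M ∧
      (S : Set C) ⊂ S' ∧ RealizesSmallSets L κ S' := by
  have hSM : S ≅[L] M := S.elementarilyEquivalent.trans h.elementarilyEquivalent.symm
  obtain ⟨F, hF, hFP⟩ := exists_sameType_covering (P := P) (v := (id : S → S)) hκ hL hSM hM hMκ hSκ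
    (realizesSmallPSets_of_pPart_eq hT hκ.aleph0_le hM C h S hS)
  -- Composing with `f` puts the copy of `S` inside the proper submodel `f(M)`; extending the
  -- inverse map to `M` then goes properly beyond `S`.
  have hx : SameType L (fun s => f (F s)) fun s : S => (s : C) :=
    (hF.trans (sameType_elementaryEmbedding f F)).symm.trans
      (sameType_elementaryEmbedding S.subtype id)
  obtain ⟨H, hH⟩ := exists_elementaryEmbedding_extending hx (hL.trans (Order.lt_succ κ))
    (Order.lt_succ_of_le hMκ) hC
  obtain ⟨S', hS'⟩ := exists_elementarySubstructure_range H
  have hHP : ∀ y, y ∈ pPart P M ↔ H y ∈ pPart P C := fun y =>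
    (sameType_elementaryEmbedding H id).rel₁_iff P y
  have hfP' : ∀ y, y ∈ pPart P M ↔ f y ∈ pPart P M := fun y =>
    (sameType_elementaryEmbedding f id).rel₁_iff P y
  have hsub : (S : Set C) ⊆ S' := fun s hs => by
    rw [hS']; exact ⟨_, hH ⟨s, hs⟩⟩
  refine ⟨S', ?_, ?_, ⟨hsub, fun hsub' => ?_⟩, hM.of_range H S' hS'⟩
  · have : #(S' : Set C) ≤ κ := by rw [hS']; exact mk_range_le.trans hMκ
    exact this
  -- No point of `P` is new: each point of `P^M` is `f` of a point of `P^M`, hence `f (F s)` for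
  -- some `s`, and `H` returns it to `s`.
  · refine Set.Subset.antisymm ?_ (hS ▸ Set.inter_subset_inter_right _ hsub)
    rintro x ⟨hxP, hxS⟩
    rw [hS'] at hxS
    obtain ⟨y, rfl⟩ := hxS
    have hy := (hHP y).2 hxP
    obtain ⟨z, rfl⟩ := hfP y hy
    obtain ⟨s, rfl⟩ := hFP z ((hfP' z).2 hy)
    rw [← hS]
    exact ⟨hxP, by rw [hH]; exact s.2⟩
  · obtain ⟨y, hy⟩ := hf
    have hyS : H y ∈ (S : Set C) := hsub' (by rw [hS']; exact ⟨y, rfl⟩)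
    exact hy ⟨F ⟨H y, hyS⟩, H.injective (hH ⟨H y, hyS⟩)⟩

theorem exists_twoCardinal_isKSaturated (hT : IsTheoryOverP T P) (hL : max L.card ℵ₀ < κ)
    (hκ : κ.IsRegular) {M : Type u} [L.Structure M] [M ⊨ T] [Nonempty M]
    (hM : RealizesSmallSets L κ M) (hMκ : #M ≤ κ)
    (f : M ↪ₑ[L] M) (hfP : ∀ y ∈ pPart P M, y ∈ Set.range f) (hf : ∃ y, y ∉ Set.range f) :
    ∃ N : Theory.ModelType.{u, u, u} T,
      IsOfType P N κ (Order.succ κ) ∧ IsKSaturated L κ N := by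
  have hκ0 := hκ.aleph0_le
  have hL' : max L.card ℵ₀ < Order.succ κ := hL.trans (Order.lt_succ κ)
  have hreg := isRegular_succ hκ0
  obtain ⟨μ, hκμ, hμ, hpow⟩ := exists_isRegular_power_le hκ0
  obtain ⟨C, hC, -⟩ := exists_realizesSmallSets T hT.complete.1 (Order.succ_le_of_lt hκμ) hL' hμ
    fun ν hν => hpow ν (Order.lt_succ_iff.1 hν)
  obtain ⟨h, -⟩ := exists_elementaryEmbedding_extending (A := PEmpty) (N := M) (C := C)
    (x := fun a => a.elim) (w := fun a => a.elim)
    (sameType_of_elementarilyEquivalent (hT.complete.models_elementarily_equivalent M C) _ _)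
    hL' (Order.lt_succ_of_le hMκ) hC
  let P0 : Set C := h '' pPart P M
  let X := {S : L.ElementarySubstructure C // #S ≤ κ ∧ pPart P C ∩ S = P0}
  obtain ⟨S0, hS0⟩ := exists_elementarySubstructure_range h
  have hS0X : #S0 ≤ κ ∧ pPart P C ∩ S0 = P0 := by
    constructor
    · have : #(S0 : Set C) ≤ κ := by rw [hS0]; exact mk_range_le.trans hMκ
      exact this
    · have hhP : ∀ y, y ∈ pPart P M ↔ h y ∈ pPart P C := fun y =>
        (sameType_elementaryEmbedding h id).rel₁_iff P y
      rw [hS0]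
      ext x
      constructor
      · rintro ⟨hx, y, rfl⟩
        exact ⟨y, (hhP y).2 hx, rfl⟩
      · rintro ⟨y, hy, rfl⟩
        exact ⟨(hhP y).1 hy, y, rfl⟩
  have : Nonempty X := ⟨⟨S0, hS0X⟩⟩
  let ι := (Order.succ κ).ord.ToType
  have hι : #ι = Order.succ κ := mk_ord_toType _
  have : Nonempty ι := mk_ne_zero_iff.1 (hι ▸ hreg.ne_zero)
  have hunion : ∀ (κ' : Type u) [LinearOrder κ'] [Nonempty κ'] (g : κ' → X),
      (∀ j k, j < k → ((g j).1 : Set C) ⊂ (g k).1) →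
      ∃ U : L.ElementarySubstructure C, (U : Set C) = (⋃ j, ((g j).1 : Set C)) ∧
        pPart P C ∩ U = P0 ∧ #U ≤ #κ' * κ := by
    intro κ' _ _ g hg
    have hmono : Monotone fun j => ((g j).1 : Set C) := fun j k hjk => by
      rcases hjk.lt_or_eq with h | rfl
      · exact (hg j k h).subset
      · exact subset_rfl
    obtain ⟨U, hU⟩ := exists_elementarySubstructure_iUnion (fun j => (g j).1) hmono.directed_le
    refine ⟨U, hU, ?_, ?_⟩
    · rw [hU, Set.inter_iUnion]
      simp only [(g _).2.2, Set.iUnion_const]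
    · have : #(U : Set C) ≤ #κ' * κ := by
        rw [hU, ← sum_const']
        exact mk_iUnion_le_sum_mk.trans (Cardinal.sum_le_sum _ _ fun j => (g j).2.1)
      exact this
  obtain ⟨g, hgsat, hglt⟩ := exists_transfinite_seq (X := X) (ι := ι)
    (fun S S' => (S.1 : Set C) ⊂ S'.1) (fun _ S => RealizesSmallSets L κ S.1) (by
      intro i g hg
      -- The union of the earlier members keeps the size bound and the `P`-part; it may lose
      -- saturation, which the next extension does not require.
      obtain ⟨U, hUX, hgU⟩ : ∃ U : L.ElementarySubstructure C,
          (#U ≤ κ ∧ pPart P C ∩ U = P0) ∧ ∀ j, ((g j).1 : Set C) ⊆ U := by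
        rcases isEmpty_or_nonempty (Set.Iio i) with hE | hne
        · exact ⟨S0, hS0X, fun j => hE.elim j⟩
        · obtain ⟨U, hU, hUP, hUc⟩ := hunion _ g hg
          refine ⟨U, ⟨hUc.trans ?_, hUP⟩, fun j => ?_⟩
          · exact (mul_le_mul_left (Order.lt_succ_iff.1 (mk_Iio_ord_lt i)) κ).trans
              (mul_eq_self hκ0).le
          · rw [hU]; exact Set.subset_iUnion (fun j => ((g j).1 : Set C)) j
      obtain ⟨S', h1, h2, h3, h4⟩ := exists_proper_extension hT hL hκ hM hMκ f hfP hf C hC h U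
        hUX.1 hUX.2
      exact ⟨⟨S', h1, h2⟩, h4, fun j => (hgU j).trans_ssubset h3⟩)
  obtain ⟨U, hU, hUP, hUc⟩ := hunion ι g hglt
  have hgmono : ∀ j k, j ≤ k → ((g j).1 : Set C) ⊆ (g k).1 := fun j k hjk => by
    rcases hjk.lt_or_eq with h | rfl
    · exact (hglt j k h).subset
    · exact subset_rfl
  have hgU : ∀ i, ((g i).1 : Set C) ⊆ U := fun i => by
    rw [hU]; exact Set.subset_iUnion (fun j => ((g j).1 : Set C)) i
  -- small subsets of the union lie in a member of the chain
  have hbdd : ∀ B : Set U, #B < Order.succ κ → ∃ i, ∀ b ∈ B, (b : C) ∈ (g i).1 := by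
    intro B hB
    have hidx : ∀ b : U, ∃ i, (b : C) ∈ (g i).1 := fun b => by
      have h1 : (b : C) ∈ (U : Set C) := b.2
      rw [hU] at h1
      exact Set.mem_iUnion.1 h1
    choose j hj using hidx
    obtain ⟨i, hi⟩ := exists_upper_bound hreg hB fun b => j b
    exact ⟨i, fun b hb => hgmono _ _ (hi ⟨b, hb⟩).le (hj b)⟩
  have hcard : #U = Order.succ κ := by
    refine le_antisymm ?_ ?_
    · rw [hι] at hUc
      exact hUc.trans ((mul_le_mul_right (Order.le_succ κ) _).trans (mul_eq_self hreg.aleph0_le).le)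
    -- A union of size at most `κ` would lie in one member, contradicting strictness at a later
    -- index.
    · by_contra! hlt
      obtain ⟨i, hi⟩ := hbdd Set.univ (by rwa [mk_univ])
      obtain ⟨k, hk⟩ := exists_upper_bound hreg (β := PUnit)
        (by simpa using one_lt_aleph0.trans_le hreg.aleph0_le) fun _ => i
      exact (hglt i k (hk ⟨⟩)).not_subset fun x hx => hi ⟨x, hgU k hx⟩ trivial
  have hPcard : #(pPart P U) = κ := by
    have hinf : (pPart P M).Infinite := hT.infinite (Theory.ModelType.of T M)
    have h1 : Subtype.val '' pPart P U = P0 := by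
      rw [← hUP]
      ext x
      constructor
      · rintro ⟨y, hy, rfl⟩
        exact ⟨(mem_pPart_coe_iff U y).1 hy, y.2⟩
      · rintro ⟨hx, hxU⟩
        exact ⟨⟨x, hxU⟩, (mem_pPart_coe_iff U ⟨x, hxU⟩).2 hx, rfl⟩
    rw [← mk_image_eq Subtype.val_injective, h1, mk_image_eq h.injective]
    exact ((mk_set_le _).trans hMκ).antisymm (hM.le_mk_pPart hκ0 hinf)
  have hsat : IsKSaturated L κ U := by
    intro B hB p hfs
    obtain ⟨i, hi⟩ := hbdd B (hB.trans (Order.lt_succ κ))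
    let w : B → (g i).1 := fun b => ⟨b.1, hi b.1 b.2⟩
    have hpκ : #p < κ := (mk_set_le p).trans_lt (mk_formula_lt L _ hL (by
      rw [mk_sum, lift_uzero]
      exact add_lt_of_lt hκ0 hB (by simpa using one_lt_aleph0.trans_le hκ0)))
    have hty : SameType L (fun b : B => (b : U)) w := by
      refine SameType.trans (sameType_elementaryEmbedding U.subtype _) ?_
      exact (sameType_elementaryEmbedding (g i).1.subtype w).symm
    obtain ⟨a, ha⟩ := hgsat i B w p hpκ fun q hq hqf => (hty.exists_iff hqf).1 (hfs q hq hqf)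
    refine ⟨⟨a, hgU i a.2⟩, fun φ hφ => ?_⟩
    rw [← elementarySubstructure_realize_iff U φ]
    have h1 := (elementarySubstructure_realize_iff (g i).1 φ _).2 (ha φ hφ)
    refine (iff_of_eq (congrArg _ ?_)).1 h1
    ext x
    rcases x with x | x <;> rfl
  exact ⟨Theory.ModelType.of T U, ⟨hPcard, hcard⟩, hsat⟩

end Chain

/-! ### Two-cardinal models, Vaughtian pairs and nonalgebraic types -/

section Equivalences

variable {L : FirstOrder.Language.{u, u}} {T : L.Theory} {P : L.Relations 1}

/-- Downward Löwenheim–Skolem over `P^N` gives a submodel of size `|P^N|`, which is too small to be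
all of `N`. -/
theorem exists_vaughtianPair_of_isTwoCardinal (N : Theory.ModelType.{u, u, u} T)
    (h : IsTwoCardinal T P N) : ∃ M : L.ElementarySubstructure N, IsVaughtianPair P M := by
  have h0 : ℵ₀ ≤ #(pPart P N) := (le_max_right _ _).trans h.1
  obtain ⟨S, hS, hcard⟩ := exists_elementarySubstructure_card_eq L (pPart P N) #(pPart P N) h0
    le_rfl (by simpa using (le_max_left _ _).trans h.1) (by simpa using h.2.le)
  simp only [lift_id] at hcard
  refine ⟨S, fun hu => ?_, ?_⟩
  · have h1 : #(S : Set N) = #(pPart P N) := hcard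
    rw [hu, mk_univ] at h1
    exact h.2.ne' h1
  · ext x
    constructor
    · rintro ⟨y, hy, rfl⟩
      exact (mem_pPart_coe_iff S y).1 hy
    · intro hx
      exact ⟨⟨x, hS hx⟩, (mem_pPart_coe_iff S ⟨x, hS hx⟩).2 hx, rfl⟩

theorem not_nulldimensional_of_isVaughtianPair (N : Theory.ModelType.{u, u, u} T)
    (M : L.ElementarySubstructure N) (h : IsVaughtianPair P M) : ¬ Nulldimensional T P := by
  obtain ⟨c, hc⟩ : ∃ c, c ∉ (M : Set N) := by
    by_contra! hall
    exact h.1 (Set.eq_univ_of_forall hall)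
  have hPM : ∀ x ∈ pPart P N, x ∈ Set.range M.subtype := by
    intro x hx
    rw [← h.2] at hx
    obtain ⟨y, -, rfl⟩ := hx
    exact ⟨y, rfl⟩
  have hmem : typeOver M.subtype (fun _ : Fin 1 => c) ∈ starTypes P M 1 := by
    refine ⟨N, inferInstance, M.subtype, fun _ => c, rfl, ?_, ?_⟩
    · ext x
      exact ⟨fun hx => ⟨hx.1, hPM x hx.1⟩, fun hx => ⟨hx.1, Or.inl hx.2⟩⟩
    · rintro k m ψ b - ⟨a, ha, ha'⟩
      exact ⟨a, fun i => ⟨ha i, Or.inl (hPM _ (ha i))⟩, ha'⟩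
  exact fun hnull => not_isAlgebraicType_typeOver M hc (hnull (Theory.ModelType.of T M) 1 _ hmem)

end Equivalences

end ModelsOverP

/-! ### The equivalence of the eight conditions. -/

theorem mainTheorem4 {L : FirstOrder.Language.{u, u}} (T : L.Theory) (P : L.Relations 1)
    (hT : IsTheoryOverP T P) (lam : Cardinal.{u})
    (hlam : theoryCard T < lam) (hpow : lam ^< lam = lam) :
    List.TFAE [
      ¬ Nulldimensional T P,
      ∃ M : Theory.ModelType.{u, u, u} T, IsSaturated L M ∧
        ∃ (n : ℕ) (p : Set (L.Formula (M ⊕ Fin n))), p ∈ starTypes P M n ∧ ¬ IsAlgebraicType p,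
      ∃ (N : Theory.ModelType.{u, u, u} T) (M : L.ElementarySubstructure N),
        IsVaughtianPair P M,
      ∃ (N : Theory.ModelType.{u, u, u} T) (M : L.ElementarySubstructure N),
        IsVaughtianPair P M ∧ HasSaturatedPPart P M ∧ #(pPart P M) = lam,
      ∃ M : Theory.ModelType.{u, u, u} T, IsTwoCardinal T P M ∧ theoryCard T < #M,
      ∃ M : Theory.ModelType.{u, u, u} T, IsTwoCardinal T P M ∧ HasSaturatedPPart P M,
      ∃ M : Theory.ModelType.{u, u, u} T, IsTwoCardinal T P M ∧
        IsOfType P M lam (Order.succ lam) ∧ HasSaturatedPPart P M,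
      ∃ M : Theory.ModelType.{u, u, u} T, IsTwoCardinal T P M ∧
        IsOfType P M lam (Order.succ lam) ∧ IsKSaturated L lam M] := by
  have hL : max L.card ℵ₀ < lam := hlam
  have hlam0 : ℵ₀ ≤ lam := (le_max_right _ _).trans hL.le
  have hreg : lam.IsRegular := isRegular_of_powerlt_eq hlam0 hpow
  have hpow' : ∀ ν < lam, lam ^ ν ≤ lam := fun ν hν => (le_powerlt lam hν).trans hpow.le
  have hpair : ¬ Nulldimensional T P → Nonempty (SaturatedPair T P lam) := fun h =>
    exists_saturatedPair_of_not_nulldimensional h hL hreg hpow'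
  tfae_have 1 → 2 := fun h =>
    let ⟨D⟩ := hpair h
    D.exists_nonalgebraic hT hL hlam0
  tfae_have 1 → 4 := fun h =>
    let ⟨D⟩ := hpair h
    D.exists_vaughtianPair hT hL hreg
  tfae_have 1 → 8 := fun h => by
    obtain ⟨D⟩ := hpair h
    obtain ⟨f, hfP, hf⟩ := D.exists_selfEmbedding hL hreg
    obtain ⟨N, htype, hsat⟩ :=
      exists_twoCardinal_isKSaturated hT hL hreg D.saturated D.mk_le f hfP hf
    refine ⟨N, ⟨?_, ?_⟩, htype, hsat⟩
    · rw [htype.1]; exact hlam.le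
    · rw [htype.1, htype.2]; exact Order.lt_succ lam
  tfae_have 2 → 1 := fun ⟨M, _, n, p, hp, halg⟩ h => halg (h M n p hp)
  tfae_have 4 → 3 := fun ⟨N, M, h, _⟩ => ⟨N, M, h⟩
  tfae_have 8 → 7 := fun ⟨M, h2, htype, hsat⟩ =>
    ⟨M, h2, htype, hasSaturatedPPart_of_isKSaturated (by rw [htype.1]; exact hsat)⟩
  tfae_have 7 → 6 := fun ⟨M, h2, _, hsat⟩ => ⟨M, h2, hsat⟩
  tfae_have 6 → 5 := fun ⟨M, h2, _⟩ => ⟨M, h2, h2.1.trans_lt h2.2⟩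
  tfae_have 5 → 3 := fun ⟨M, h2, _⟩ => ⟨M, exists_vaughtianPair_of_isTwoCardinal M h2⟩
  tfae_have 3 → 1 := fun ⟨N, M, h⟩ => not_nulldimensional_of_isVaughtianPair N M h
  tfae_finish
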